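/- Let $k$ be an algebraically closed field of characteristic $p>0$, let $q_0,\dots,q_N$ be positive integers ($N\ge 0$), and let $A=k[x_0,\dots,x_N]$ be graded by $\deg(x_i)=q_i$. Put $d=q_0+\cdots+q_N$ and $\Lambda=\{\alpha=(a_0,\dots,a_N)\in\mathbb Z_{\ge 0}^{N+1}\mid q_0a_0+\cdots+q_Na_N=d\}$, and for $b=(b_\alpha)_{\alpha\in\Lambda}\in k^{\Lambda}$ let $G(b)=\sum_{\alpha\in\Lambda}b_\alpha x^\alpha$. For a ring $R$ of characteristic $p$ let $W_n(R)$ be the ring of $p$-typical Witt vectors of length $n\ge 1$, with its Frobenius $F$ and the restriction $W_n(R)\to R$, $(a_0,\dots,a_{n-1})\mapsto a_0$. The ring $R$ is $n$-quasi-$F$-split if there is a $W_n(R)$-linear map $\varphi\colon F_*W_n(R)\to R$ such that $\varphi\circ F$ is the restriction; it is quasi-$F$-split if it is $n$-quasi-$F$-split for some $n\ge1$. For a $\mathbb Q$-divisor $E$ on $\operatorname{Spec}A$ put $A(E)=\{a\in\operatorname{Frac}A\mid a=0\text{ or }\operatorname{div}(a)+E\ge 0\}$ and $W_n(A)(E)=\{(a_0,\dots,a_{n-1})\in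 W_n(\operatorname{Frac}A)\mid a_i\in A(p^iE)\text{ for all }i\}$. For an effective $\mathbb Q$-divisor $D$, the pair $(A,D)$ is $n$-quasi-$F$-split if there is a $W_n(A)$-linear map $\varphi\colon F_*\bigl(W_n(A)(pD)\bigr)\to A$ such that the composition of $F\colon W_n(A)\to F_*W_n(A)\subseteq F_*\bigl(W_n(A)(pD)\bigr)$ with $\varphi$ is the restriction $W_n(A)\to A$. For $0\ne f\in A$, the non-splitting index of $f$ is $$\mathrm{ns}(f)=\inf\Bigl\{n\in\mathbb Z_{\ge1}\Bigm|\bigl(A,\bigl(1-\tfrac{2}{p^n}\bigr)\operatorname{div}(f)\bigr)\text{ is not }n\text{-quasi-}F\text{-split}\Bigr\}\in\mathbb Z_{\ge1}\cup\{\infty\},\qquad \inf\emptyset=\infty .$$ Then, for every $b\neq 0$, the ring $A/(G(b))$ is not quasi-$F$-split if and only if $\mathrm{ns}(G(b))<\infty$. -/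

import Mathlib

noncomputable section

namespace QuasiFSplit

/-! ### Truncated Witt vectors -/

/-- The Frobenius `F` of `W_n(R)`, given by the `p`-th power on every component. On rings of
characteristic `p` (the only ones to which it is applied) it is a ring endomorphism. -/
def wittF (p : ℕ) {n : ℕ} {R : Type*} [CommRing R] (a : TruncatedWittVector p n R) :
    TruncatedWittVector p n R :=
  TruncatedWittVector.mk p fun i => a.coeff i ^ p

/-- The ring homomorphism `W_n(R) → W_n(S)` induced by a ring homomorphism `R → S`. -/
def wittMap {p n : ℕ} {R S : Type*} [CommRing R] [CommRing S] (g : R →+* S)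
    (a : TruncatedWittVector p n R) : TruncatedWittVector p n S :=
  TruncatedWittVector.mk p fun i => g (a.coeff i)

/-! ### Quasi-`F`-split rings -/

/-- A ring `R` of characteristic `p` is `n`-quasi-`F`-split (`n ≥ 1`) if there is a
`W_n(R)`-linear map `φ : F_* W_n(R) → R` whose composition with `F : W_n(R) → F_* W_n(R)` is the
restriction `W_n(R) → R`, `a ↦ a₀`. Here `W_n(R)` acts on `F_* W_n(R)` through `F` and on `R`
through the restriction. -/
def IsNQuasiFSplit (p : ℕ) [Fact p.Prime] (n : ℕ) (R : Type*) [CommRing R] : Prop :=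
  ∃ (hn : 0 < n) (φ : TruncatedWittVector p n R →+ R),
    (∀ w a : TruncatedWittVector p n R, φ (wittF p w * a) = w.coeff ⟨0, hn⟩ * φ a) ∧
    ∀ a : TruncatedWittVector p n R, φ (wittF p a) = a.coeff ⟨0, hn⟩

/-- A ring of characteristic `p` is quasi-`F`-split if it is `n`-quasi-`F`-split for some
`n ≥ 1`. -/
def IsQuasiFSplit (p : ℕ) [Fact p.Prime] (R : Type*) [CommRing R] : Prop :=
  ∃ n : ℕ, IsNQuasiFSplit p n R

/-! ### Divisors with rational coefficients on a factorial domain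

The prime divisors of `Spec A` are the ideals `(π)`, for `π` a prime element of `A`. A
`ℚ`-divisor is given by its coefficients, as a function of `π`. -/

section Divisors

variable {A : Type*} [CommRing A] [IsDomain A] [UniqueFactorizationMonoid A]

/-- The order along the prime `π` of a nonzero element `a` of the field of fractions of `A`. -/
def ordAt (π : A) (a : FractionRing A) : ℤ :=
  (multiplicity π (IsFractionRing.num A a) : ℤ) -
    (multiplicity π (IsFractionRing.den A a : A) : ℤ)

/-- The `ℚ`-divisor `c · div(f)`, for `f ≠ 0`. -/
def ratDiv (c : ℚ) (f : A) : A → ℚ :=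
  fun π => c * (ordAt π (algebraMap A (FractionRing A) f) : ℚ)

/-- `A(E) = {a ∈ Frac A ∣ a = 0 or div(a) + E ≥ 0}` for a `ℚ`-divisor `E`. -/
def divSections (E : A → ℚ) : Set (FractionRing A) :=
  {a | a = 0 ∨ ∀ π : A, Prime π → 0 ≤ (ordAt π a : ℚ) + E π}

/-- `W_n(A)(E)`: the truncated Witt vectors `(a₀, …, a_{n-1})` over `Frac A` with
`a_i ∈ A(p^i E)` for all `i`. It is a `W_n(A)`-submodule of `W_n(Frac A)`. -/
def wittSections (p n : ℕ) (E : A → ℚ) : Set (TruncatedWittVector p n (FractionRing A)) :=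
  {α | ∀ i : Fin n, α.coeff i ∈ divSections fun π => (p : ℚ) ^ (i : ℕ) * E π}

/-- The pair `(A, D)`, where `A` has characteristic `p` and `D ≥ 0`, is `n`-quasi-`F`-split
(`n ≥ 1`) if there is a `W_n(A)`-linear map `φ : F_* (W_n(A)(pD)) → A` whose composition with
`W_n(A) → F_* W_n(A) ⊆ F_* (W_n(A)(pD))`, the first map being `F`, is the restriction
`W_n(A) → A`. Equivalently, `1 ∈ A` is in the image of the evaluation map `Hom(Q, A) → A`, where
`Q` is the pushout of `W_n(A) → F_* (W_n(A)(pD))` and `W_n(A) → A`.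

The map `φ` is given as a function on `W_n(Frac A)`, of which only the values on `W_n(A)(pD)`
are used. -/
def IsNQuasiFSplitPair (p : ℕ) [Fact p.Prime] (n : ℕ) (D : A → ℚ) : Prop :=
  ∃ (hn : 0 < n) (φ : TruncatedWittVector p n (FractionRing A) → A),
    (∀ α ∈ wittSections p n (fun π => (p : ℚ) * D π),
      ∀ β ∈ wittSections p n (fun π => (p : ℚ) * D π), φ (α + β) = φ α + φ β) ∧
    (∀ w : TruncatedWittVector p n A, ∀ α ∈ wittSections p n (fun π => (p : ℚ) * D π),
      φ (wittMap (algebraMap A (FractionRing A)) (wittF p w) * α) = w.coeff ⟨0, hn⟩ * φ α) ∧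
    ∀ a : TruncatedWittVector p n A,
      φ (wittMap (algebraMap A (FractionRing A)) (wittF p a)) = a.coeff ⟨0, hn⟩

/-- The non-splitting index of `f ≠ 0`: the infimum in `ℕ ∪ {∞}` of the `n ≥ 1` for which the
pair `(A, (1 - 2 / p ^ n) div(f))` is not `n`-quasi-`F`-split; it is `∞` if there is no such
`n`. -/
def ns (p : ℕ) [Fact p.Prime] (f : A) : ℕ∞ :=
  ⨅ n ∈ {n : ℕ | 1 ≤ n ∧ ¬ IsNQuasiFSplitPair p n (ratDiv (1 - 2 / (p : ℚ) ^ n) f)}, (n : ℕ∞)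

end Divisors

/-! ### Polynomials of Calabi–Yau degree -/

section CalabiYau

variable {N : ℕ}

/-- The set `Λ` of the exponents `α = (a_0, …, a_N)` with `∑ q_i a_i = d := ∑ q_i`. (As all
`q_i` are positive, the bounds `a_i ≤ d` hold for every such `α`.) -/
def cyExponents (q : Fin (N + 1) → ℕ) : Finset (Fin (N + 1) → ℕ) :=
  (Fintype.piFinset fun _ => Finset.range (∑ i, q i + 1)).filter
    fun a => ∑ i, q i * a i = ∑ i, q i

theorem mem_cyExponents {q : Fin (N + 1) → ℕ} (hq : ∀ i, 0 < q i) (a : Fin (N + 1) → ℕ) :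
    a ∈ cyExponents q ↔ ∑ i, q i * a i = ∑ i, q i := by
  simp only [cyExponents, Finset.mem_filter, Fintype.mem_piFinset, Finset.mem_range,
    and_iff_right_iff_imp]
  intro h j
  have h1 : q j * a j ≤ ∑ i, q i * a i :=
    Finset.single_le_sum (f := fun i => q i * a i) (fun _ _ => Nat.zero_le _) (Finset.mem_univ j)
  have h2 : a j ≤ q j * a j := Nat.le_mul_of_pos_left _ (hq j)
  omega

/-- `G(b) = ∑_{α ∈ Λ} b_α x^α`, the general polynomial that is homogeneous of degree
`d = ∑ q_i` for the grading with `deg x_i = q_i`. -/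
def cyPoly {k : Type*} [Field k] (q : Fin (N + 1) → ℕ) (b : cyExponents q → k) :
    MvPolynomial (Fin (N + 1)) k :=
  ∑ α : cyExponents q, MvPolynomial.monomial (Finsupp.equivFunOnFinite.symm α.1) (b α)

end CalabiYau

end QuasiFSplit

end

/-! Let A = k[x], f = G(b), let u be the Cartier operator of A, and let T(a) in W(A) be the sum of
the Teichmüller lifts of the terms of a. Both notions of splitting are governed by the same object
(`IsSplitting`): an additive map χ from W_n(A) to A/(f), linear through F, with χ(1) = 1, killing
the Witt vectors with components in (f), …, (f), (f^r). For the ring A/(f) one has r = 1. For the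
pair with D = (1 - 2/p^n) div(f) one has r = 2: if f is squarefree, the i-th component of a section
has a pole of order at most p^(i+1) - 1 along f for i < n - 1, and at most p^n - 2 for i = n - 1, so
multiplication by F[f] brings it into (f), respectively (f^2).

Such a χ kills p = VF, and T is additive modulo p, so χ is encoded by polynomials h_j with χ(V^j
T(a)) = u^(j+1)(h_j a) mod f. Up to terms that do not contribute, [f] is T(f) + V T(Δ(f)), and
vanishing of χ becomes a system of divisibilities. They force h_j = f^(p^(j+1) - 2) a_j, where,
modulo f, a_j = θ(a_{j+1}) with θ(a) = -u(f^(p-2) Δ(f) a), and u(f^(p-2) a_j) is 0 for j ≥ 1 and 1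
for j = 0; moreover f^(2-r) divides the last term (`IsSplitting.exists_chain`). Conversely, such a
chain, with the conditions on u(f^(p-2) a_j) holding exactly, defines a splitting
(`exists_splitting_of_chain`).

Since deg f is the sum d of the weights, θ preserves degree d, a ↦ u(f^(p-2) a) maps degree d to
constants, and the multiples of f of degree d are the line k f. Degree d components thus give chains
in the finite-dimensional space A_d, with a_j in θ(a_{j+1}) + k f. Splittings of A/(f) correspond to
chains ending in k f, splittings of the pairs to chains with arbitrary last term.

A chain ending in k f can be truncated or padded with zeros to any length. Conversely, chains of all
lengths produce one ending in k f (`exists_isChain_smul`): with l the functional u(f^(p-2) ·),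
either l(θ^i f) ≠ 0 for some i, and iterates of θ on a multiple of f form a chain, or the summands
from k f are invisible to all l ∘ θ^i and the stabilization of a descending sequence of subspaces is
contradicted. Squarefreeness of f, needed to round the pole orders, holds because quasi-F-split
rings are reduced. -/

noncomputable section

namespace QuasiFSplit

open MvPolynomial

set_option linter.unusedSectionVars false

/-! ### The Cartier operators on a polynomial ring over a perfect field -/

section Cartier

variable {σ k : Type*} [Finite σ] [Field k] (p : ℕ)

/-- The exponent `p ^ m * e + (p ^ m - 1)`. -/
def cartierExp (m : ℕ) (e : σ →₀ ℕ) : σ →₀ ℕ :=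
  Finsupp.equivFunOnFinite.symm fun i => p ^ m * e i + (p ^ m - 1)

@[simp] theorem cartierExp_apply (m : ℕ) (e : σ →₀ ℕ) (i : σ) :
    cartierExp p m e i = p ^ m * e i + (p ^ m - 1) := rfl

variable [Fact p.Prime] [CharP k p] [PerfectRing k p]

theorem cartierExp_injective (m : ℕ) : Function.Injective (cartierExp (σ := σ) p m) := by
  intro e e' h
  ext i
  have h1 := DFunLike.congr_fun h i
  simp only [cartierExp_apply, Nat.add_right_cancel_iff] at h1
  exact Nat.eq_of_mul_eq_mul_left (pow_pos (Fact.out : p.Prime).pos m) h1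

theorem cartierExp_cartierExp (l m : ℕ) (e : σ →₀ ℕ) :
    cartierExp p m (cartierExp p l e) = cartierExp p (l + m) e := by
  ext i
  simp only [cartierExp_apply]
  have h1 : 0 < p ^ m := pow_pos (Fact.out : p.Prime).pos m
  have h2 : 0 < p ^ l := pow_pos (Fact.out : p.Prime).pos l
  obtain ⟨a, ha⟩ := Nat.exists_eq_add_of_lt h1
  obtain ⟨b, hb⟩ := Nat.exists_eq_add_of_lt h2
  have h3 : p ^ (l + m) = (a + 1) * (b + 1) := by rw [pow_add, ha, hb]; ring
  rw [h3, ha, hb]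
  have : (a + 1) * (b + 1) - 1 = (a + 1) * b + a := by
    rw [Nat.sub_eq_iff_eq_add (by nlinarith)]; ring
  rw [this]
  simp only [zero_add, Nat.add_sub_cancel]
  ring

/-- The `p ^ m`-th root in a perfect ring. -/
def root (m : ℕ) : k ≃+* k := (iterateFrobeniusEquiv k p m).symm

@[simp] theorem root_pow (m : ℕ) (c : k) : root p m (c ^ p ^ m) = c := by
  rw [root, ← iterateFrobeniusEquiv_def, RingEquiv.symm_apply_apply]

@[simp] theorem pow_root (m : ℕ) (c : k) : root p m c ^ p ^ m = c := by
  rw [root, ← iterateFrobeniusEquiv_def, RingEquiv.apply_symm_apply]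

theorem root_root (l m : ℕ) (c : k) : root p l (root p m c) = root p (l + m) c := by
  rw [root, root, root, ← iterateFrobeniusEquiv_symm_add_apply]

theorem exists_cartier (m : ℕ) (a : MvPolynomial σ k) :
    ∃ b : MvPolynomial σ k, ∀ e, coeff e b = root p m (coeff (cartierExp p m e) a) := by
  classical
  induction a using MvPolynomial.induction_on' with
  | monomial v c =>
    by_cases h : ∃ e, cartierExp p m e = v
    · obtain ⟨e, rfl⟩ := h
      refine ⟨monomial e (root p m c), fun e' => ?_⟩
      simp only [coeff_monomial, (cartierExp_injective p m).eq_iff]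
      split_ifs <;> simp
    · refine ⟨0, fun e' => ?_⟩
      rw [coeff_monomial, if_neg (fun h' => h ⟨e', h'.symm⟩)]
      simp
  | add a a' h h' =>
    obtain ⟨b, hb⟩ := h
    obtain ⟨b', hb'⟩ := h'
    exact ⟨b + b', fun e => by simp [hb, hb']⟩

/-- The `m`-fold Cartier operator on `k[x]`: the `p ^ (-m)`-linear map which sends
`x ^ (p ^ m * e + (p ^ m - 1))` to `x ^ e` and kills all other monomials. -/
def cartier (m : ℕ) : MvPolynomial σ k →+ MvPolynomial σ k where
  toFun a := (exists_cartier p m a).choose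
  map_zero' := by
    ext e
    rw [(exists_cartier p m (0 : MvPolynomial σ k)).choose_spec]
    simp
  map_add' a b := by
    ext e
    rw [(exists_cartier p m (a + b)).choose_spec, coeff_add, coeff_add,
      (exists_cartier p m a).choose_spec, (exists_cartier p m b).choose_spec, map_add]

theorem coeff_cartier (m : ℕ) (a : MvPolynomial σ k) (e : σ →₀ ℕ) :
    coeff e (cartier p m a) = root p m (coeff (cartierExp p m e) a) :=
  (exists_cartier p m a).choose_spec e

theorem cartier_cartier (l m : ℕ) (a : MvPolynomial σ k) :
    cartier p l (cartier p m a) = cartier p (l + m) a := by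
  ext e
  rw [coeff_cartier, coeff_cartier, coeff_cartier, cartierExp_cartierExp, root_root]

theorem add_pow_prime_pow {R : Type*} [CommRing R] [CharP R p] (m : ℕ) (a b : R) :
    (a + b) ^ p ^ m = a ^ p ^ m + b ^ p ^ m := add_pow_char_pow a b p m

theorem cartier_pow_mul (m : ℕ) (a b : MvPolynomial σ k) :
    cartier p m (a ^ p ^ m * b) = a * cartier p m b := by
  classical
  induction a using MvPolynomial.induction_on' with
  | monomial s c =>
    ext e
    rw [coeff_cartier, monomial_pow, coeff_monomial_mul', coeff_monomial_mul', coeff_cartier]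
    have hq : 0 < p ^ m := pow_pos (Fact.out : p.Prime).pos m
    have h : p ^ m • s ≤ cartierExp p m e ↔ s ≤ e := by
      rw [Finsupp.le_def, Finsupp.le_def]
      refine forall_congr' fun i => ?_
      simp only [Finsupp.smul_apply, smul_eq_mul, cartierExp_apply]
      constructor
      · intro h
        by_contra! hlt
        have : p ^ m * (e i + 1) ≤ p ^ m * s i := Nat.mul_le_mul_left _ hlt
        rw [mul_add] at this
        omega
      · intro h
        have : p ^ m * s i ≤ p ^ m * e i := Nat.mul_le_mul_left _ h
        omega
    by_cases hs : s ≤ e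
    · rw [if_pos hs, if_pos (h.2 hs), map_mul, root_pow]
      congr 3
      ext i
      simp only [Finsupp.tsub_apply, Finsupp.smul_apply, smul_eq_mul, cartierExp_apply, Nat.mul_sub]
      have : p ^ m * s i ≤ p ^ m * e i := Nat.mul_le_mul_left _ (hs i)
      omega
    · rw [if_neg hs, if_neg (fun h' => hs (h.1 h')), map_zero]
  | add a a' h h' =>
    rw [add_pow_prime_pow, add_mul, map_add, h, h', add_mul]

theorem cartier_mul_pow (m : ℕ) (a b : MvPolynomial σ k) :
    cartier p m (a * b ^ p ^ m) = b * cartier p m a := by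
  rw [mul_comm, cartier_pow_mul]

theorem cartier_one_pow_mul (a b : MvPolynomial σ k) :
    cartier p 1 (a ^ p * b) = a * cartier p 1 b := by
  simpa using cartier_pow_mul p 1 a b

/-- The exponents `e` with `e i < p ^ m` for all `i`. -/
def smallExp (m : ℕ) (r : σ → Fin (p ^ m)) : σ →₀ ℕ :=
  Finsupp.equivFunOnFinite.symm fun i => (r i : ℕ)

/-- The complementary exponents `p ^ m - 1 - r`. -/
def smallExpCompl (m : ℕ) (r : σ → Fin (p ^ m)) : σ →₀ ℕ :=
  Finsupp.equivFunOnFinite.symm fun i => p ^ m - 1 - (r i : ℕ)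

theorem exists_eq_smul_add_smallExp (m : ℕ) (e : σ →₀ ℕ) :
    ∃ (s : σ →₀ ℕ) (r : σ → Fin (p ^ m)), e = p ^ m • s + smallExp p m r := by
  have hq : 0 < p ^ m := pow_pos (Fact.out : p.Prime).pos m
  refine ⟨Finsupp.equivFunOnFinite.symm fun i => e i / p ^ m,
    fun i => ⟨e i % p ^ m, Nat.mod_lt _ hq⟩, ?_⟩
  ext i
  simp [smallExp, Nat.div_add_mod]

/-- The monomials with exponents below p^m and their complements are dual bases for (a, b) ↦
u^m(ab): each exponent of the product is at most 2(p^m - 1), so it is congruent to -1 modulo p^m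
only when it equals p^m - 1. -/
theorem cartier_monomial_smallExp (m : ℕ) (r r' : σ → Fin (p ^ m)) [Decidable (r = r')] :
    cartier p m (monomial (smallExpCompl p m r + smallExp p m r') (1 : k)) =
      if r = r' then 1 else 0 := by
  classical
  have hq : 0 < p ^ m := pow_pos (Fact.out : p.Prime).pos m
  ext e
  rw [coeff_cartier, coeff_monomial]
  have key : smallExpCompl p m r + smallExp p m r' = cartierExp p m e ↔ r = r' ∧ 0 = e := by
    constructor
    · intro h
      have h1 : ∀ i, p ^ m - 1 - (r i : ℕ) + (r' i : ℕ) = p ^ m * e i + (p ^ m - 1) :=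
        fun i => DFunLike.congr_fun h i
      have h2 : ∀ i, e i = 0 := by
        intro i
        by_contra hne
        have h3 := h1 i
        have h4 := (r i).2
        have h5 := (r' i).2
        have : p ^ m * 1 ≤ p ^ m * e i := Nat.mul_le_mul_left _ (Nat.pos_of_ne_zero hne)
        omega
      refine ⟨funext fun i => Fin.ext ?_, Finsupp.ext fun i => (h2 i).symm⟩
      have h3 := h1 i
      rw [h2 i] at h3
      have h4 := (r i).2
      have h5 := (r' i).2
      omega
    · rintro ⟨rfl, rfl⟩
      ext i
      have h4 := (r i).2
      simp only [smallExpCompl, smallExp, Finsupp.add_apply, Finsupp.equivFunOnFinite_symm_apply_apply,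
        cartierExp_apply, Finsupp.zero_apply]
      omega
  by_cases h : r = r'
  · simp only [if_pos h, coeff_one]
    by_cases h0 : (0 : σ →₀ ℕ) = e
    · rw [if_pos (key.2 ⟨h, h0⟩), if_pos h0, map_one]
    · rw [if_neg (fun h' => h0 (key.1 h').2), if_neg h0, map_zero]
  · rw [if_neg (fun h' => h (key.1 h').1), if_neg h, map_zero, coeff_zero]

theorem dvd_cartier_of_pow_dvd (m : ℕ) {f h : MvPolynomial σ k} (H : f ^ p ^ m ∣ h) :
    f ∣ cartier p m h := by
  obtain ⟨g, rfl⟩ := H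
  rw [cartier_pow_mul]
  exact Dvd.intro _ rfl

variable [Fintype σ] [DecidableEq σ]

/-- Prescribing a `p ^ (-m)`-linear map on the basis `x ^ r`, `r < p ^ m`. -/
theorem cartier_sum_mul (m : ℕ) (g : (σ → Fin (p ^ m)) → MvPolynomial σ k)
    (r : σ → Fin (p ^ m)) :
    cartier p m ((∑ r', g r' ^ p ^ m * monomial (smallExpCompl p m r') 1) *
      monomial (smallExp p m r) 1) = g r := by
  classical
  rw [Finset.sum_mul, map_sum, Finset.sum_eq_single r]
  · rw [mul_assoc, cartier_pow_mul, monomial_mul, one_mul, cartier_monomial_smallExp, if_pos rfl,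
      mul_one]
  · intro r' _ hne
    rw [mul_assoc, cartier_pow_mul, monomial_mul, one_mul, cartier_monomial_smallExp, if_neg hne,
      mul_zero]
  · simp

/-- The duality between `k[x]` and itself given by the Cartier operator. -/
theorem eq_sum_cartier (m : ℕ) (h : MvPolynomial σ k) :
    h = ∑ r, cartier p m (h * monomial (smallExp p m r) 1) ^ p ^ m *
      monomial (smallExpCompl p m r) 1 := by
  classical
  have hq : 0 < p ^ m := pow_pos (Fact.out : p.Prime).pos m
  induction h using MvPolynomial.induction_on' with
  | monomial e c =>
    obtain ⟨s, r, rfl⟩ := exists_eq_smul_add_smallExp p m e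
    obtain ⟨r₀, hr₀⟩ : ∃ r₀ : σ → Fin (p ^ m), smallExp p m r = smallExpCompl p m r₀ := by
      refine ⟨fun i => ⟨p ^ m - 1 - (r i : ℕ), by omega⟩, ?_⟩
      ext i
      have := (r i).2
      simp only [smallExp, smallExpCompl, Finsupp.equivFunOnFinite_symm_apply_apply]
      omega
    have h1 : ∀ r' : σ → Fin (p ^ m), cartier p m
        (monomial (p ^ m • s + smallExp p m r) c * monomial (smallExp p m r') 1) =
        if r₀ = r' then monomial s (root p m c) else 0 := by
      intro r'
      have : monomial (p ^ m • s + smallExp p m r) c * monomial (smallExp p m r') 1 =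
          monomial s (root p m c) ^ p ^ m *
            monomial (smallExpCompl p m r₀ + smallExp p m r') 1 := by
        rw [monomial_pow, pow_root, monomial_mul, monomial_mul, hr₀, add_assoc]
      rw [this, cartier_pow_mul, cartier_monomial_smallExp]
      split_ifs <;> simp
    simp only [h1]
    rw [Finset.sum_eq_single r₀]
    · rw [if_pos rfl, monomial_pow, pow_root, monomial_mul, mul_one, hr₀]
    · intro r' _ hne
      rw [if_neg hne.symm, zero_pow hq.ne', zero_mul]
    · simp
  | add a b ha hb =>
    conv_lhs => rw [ha, hb]
    rw [← Finset.sum_add_distrib]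
    refine Finset.sum_congr rfl fun r _ => ?_
    rw [add_mul, map_add, add_pow_prime_pow, add_mul]

/-- A principal ideal is generated by `f ^ p ^ m` if its image under Cartier lies in `(f)`. -/
theorem pow_dvd_of_dvd_cartier (m : ℕ) {f h : MvPolynomial σ k}
    (H : ∀ e, f ∣ cartier p m (h * monomial e 1)) : f ^ p ^ m ∣ h := by
  rw [eq_sum_cartier p m h]
  exact Finset.dvd_sum fun r _ => Dvd.dvd.mul_right (pow_dvd_pow_of_dvd (H _) _) _

end Cartier

/-! ### Teichmüller expansions of Witt vectors over a polynomial ring -/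

section Teichmuller

variable {σ k : Type*} [Field k] (p : ℕ) [Fact p.Prime]

/-- The ring homomorphism `W(k)[x] → W(k[x])` which sends `x_i` to its Teichmüller lift. -/
def teichHom : MvPolynomial σ (WittVector p k) →+* WittVector p (MvPolynomial σ k) :=
  eval₂Hom (WittVector.map C) fun i => WittVector.teichmuller p (X i)

/-- Reduction modulo `p`. -/
def red : MvPolynomial σ (WittVector p k) →+* MvPolynomial σ k :=
  MvPolynomial.map WittVector.constantCoeff

/-- The lift of Frobenius to `W(k)[x]` which sends `x_i` to `x_i ^ p`. -/
def frobLift : MvPolynomial σ (WittVector p k) →+* MvPolynomial σ (WittVector p k) :=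
  (expand p : _ →ₐ[WittVector p k] _).toRingHom.comp (MvPolynomial.map WittVector.frobenius)

theorem teichHom_monomial (e : σ →₀ ℕ) (c : WittVector p k) :
    teichHom p (monomial e c) =
      WittVector.map C c * WittVector.teichmuller p (monomial e (1 : k)) := by
  rw [teichHom, coe_eval₂Hom, eval₂_monomial, monomial_eq (s := e) (a := (1 : k))]
  simp only [Finsupp.prod, map_one, one_mul, map_prod, map_pow]

theorem teichHom_coeff_zero (P : MvPolynomial σ (WittVector p k)) :
    (teichHom p P).coeff 0 = red p P := by
  have : (WittVector.constantCoeff : WittVector p (MvPolynomial σ k) →+* _).comp (teichHom p) =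
      red p := by
    apply MvPolynomial.ringHom_ext
    · intro c
      simp [teichHom, red]
    · intro i
      simp [teichHom, red]
  exact DFunLike.congr_fun this P

/-- The lift of a polynomial with Teichmüller coefficients. -/
def polyLift (a : MvPolynomial σ k) : MvPolynomial σ (WittVector p k) :=
  ∑ e ∈ a.support, monomial e (WittVector.teichmuller p (coeff e a))

theorem coeff_polyLift (a : MvPolynomial σ k) (e : σ →₀ ℕ) :
    coeff e (polyLift p a) = WittVector.teichmuller p (coeff e a) := by
  classical
  simp only [polyLift, coeff_sum, coeff_monomial]
  rw [Finset.sum_ite_eq']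
  split_ifs with h
  · rfl
  · rw [notMem_support_iff.1 h, WittVector.teichmuller_zero]

theorem polyLift_monomial (e : σ →₀ ℕ) (c : k) :
    polyLift p (monomial e c) = monomial e (WittVector.teichmuller p c) := by
  classical
  ext1 e'
  rw [coeff_polyLift, coeff_monomial, coeff_monomial]
  split_ifs
  · rfl
  · exact WittVector.teichmuller_zero p

theorem red_polyLift (a : MvPolynomial σ k) : red p (polyLift p a) = a := by
  ext e
  rw [red, coeff_map, coeff_polyLift]
  exact WittVector.teichmuller_coeff_zero p _

theorem polyLift_zero : polyLift p (0 : MvPolynomial σ k) = 0 := by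
  simp [polyLift]

theorem polyLift_monomial_mul (e : σ →₀ ℕ) (c : k) (a : MvPolynomial σ k) :
    polyLift p (monomial e c * a) = monomial e (WittVector.teichmuller p c) * polyLift p a := by
  classical
  ext1 e'
  rw [coeff_polyLift, coeff_monomial_mul', coeff_monomial_mul', coeff_polyLift]
  split_ifs
  · rw [map_mul]
  · exact WittVector.teichmuller_zero p

/-- The sum of the Teichmüller lifts of the monomials of a polynomial. -/
def teichSum (a : MvPolynomial σ k) : WittVector p (MvPolynomial σ k) :=
  teichHom p (polyLift p a)

theorem teichSum_coeff_zero (a : MvPolynomial σ k) : (teichSum p a).coeff 0 = a := by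
  rw [teichSum, teichHom_coeff_zero, red_polyLift]

theorem teichSum_zero : teichSum p (0 : MvPolynomial σ k) = 0 := by
  rw [teichSum, polyLift_zero, map_zero]

theorem teichSum_monomial (e : σ →₀ ℕ) (c : k) :
    teichSum p (monomial e c) = WittVector.teichmuller p (monomial e c) := by
  rw [teichSum, polyLift_monomial, teichHom_monomial, WittVector.map_teichmuller, ← map_mul,
    C_mul_monomial, mul_one]

theorem teichSum_one : teichSum p (1 : MvPolynomial σ k) = 1 := by
  have := teichSum_monomial p (0 : σ →₀ ℕ) (1 : k)
  simpa using this

theorem teichSum_monomial_mul (e : σ →₀ ℕ) (c : k) (a : MvPolynomial σ k) :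
    teichSum p (monomial e c * a) =
      WittVector.teichmuller p (monomial e c) * teichSum p a := by
  rw [← teichSum_monomial, teichSum, teichSum, teichSum, polyLift_monomial_mul, map_mul,
    polyLift_monomial]

/-- The shift of a Witt vector minus the Teichmüller expansion of its first component. -/
def teichTail (α : WittVector p (MvPolynomial σ k)) : WittVector p (MvPolynomial σ k) :=
  (α - teichSum p (α.coeff 0)).shift 1

theorem teichSum_add_teichTail (α : WittVector p (MvPolynomial σ k)) :
    α = teichSum p (α.coeff 0) + WittVector.verschiebung (teichTail p α) := by
  have h : (α - teichSum p (α.coeff 0)).coeff 0 = 0 := by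
    have := map_sub (WittVector.constantCoeff : WittVector p (MvPolynomial σ k) →+* _) α
      (teichSum p (α.coeff 0))
    simpa [WittVector.constantCoeff_apply, teichSum_coeff_zero] using this
  have h2 := WittVector.verschiebung_shift (α - teichSum p (α.coeff 0)) 0 (by
    intro i hi
    obtain rfl : i = 0 := by omega
    exact h)
  have h3 : (α - teichSum p (α.coeff 0)).shift 0 = α - teichSum p (α.coeff 0) := by
    ext n
    simp [WittVector.shift_coeff]
  rw [teichTail, h2.trans h3]
  ring

theorem coeff_zero_teichSum_add (a : MvPolynomial σ k) (β : WittVector p (MvPolynomial σ k)) :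
    (teichSum p a + WittVector.verschiebung β).coeff 0 = a := by
  have := map_add (WittVector.constantCoeff : WittVector p (MvPolynomial σ k) →+* _)
    (teichSum p a) (WittVector.verschiebung β)
  simpa [WittVector.constantCoeff_apply, teichSum_coeff_zero] using this

theorem teichTail_teichSum_add (a : MvPolynomial σ k) (β : WittVector p (MvPolynomial σ k)) :
    teichTail p (teichSum p a + WittVector.verschiebung β) = β := by
  have h := teichSum_add_teichTail p (teichSum p a + WittVector.verschiebung β)
  rw [coeff_zero_teichSum_add] at h
  exact (WittVector.verschiebung_injective p _ (add_left_cancel h)).symm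

theorem teichTail_eq {α : WittVector p (MvPolynomial σ k)} {a : MvPolynomial σ k}
    {β : WittVector p (MvPolynomial σ k)}
    (h : α = teichSum p a + WittVector.verschiebung β) : teichTail p α = β := by
  rw [h, teichTail_teichSum_add]

variable [CharP k p]

theorem frobenius_teichmuller {R : Type*} [CommRing R] [CharP R p] (a : R) :
    WittVector.frobenius (WittVector.teichmuller p a) = WittVector.teichmuller p a ^ p := by
  rw [← map_pow]
  ext n
  rw [WittVector.coeff_frobenius_charP]
  cases n with
  | zero => rw [WittVector.teichmuller_coeff_zero, WittVector.teichmuller_coeff_zero]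
  | succ n =>
    rw [WittVector.teichmuller_coeff_pos p _ _ n.succ_pos,
      WittVector.teichmuller_coeff_pos p _ _ n.succ_pos, zero_pow (Fact.out : p.Prime).ne_zero]

theorem frobenius_teichHom (P : MvPolynomial σ (WittVector p k)) :
    WittVector.frobenius (teichHom p P) = teichHom p (frobLift p P) := by
  have : (WittVector.frobenius : WittVector p (MvPolynomial σ k) →+* _).comp (teichHom p) =
      (teichHom p).comp (frobLift p) := by
    apply MvPolynomial.ringHom_ext
    · intro c
      simp only [teichHom, frobLift, RingHom.comp_apply, coe_eval₂Hom, eval₂_C, map_C,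
        AlgHom.toRingHom_eq_coe, RingHom.coe_coe, expand_C]
      ext n
      simp [WittVector.coeff_frobenius_charP, WittVector.map_coeff]
    · intro i
      simp only [teichHom, frobLift, RingHom.comp_apply, coe_eval₂Hom, eval₂_X, map_X,
        AlgHom.toRingHom_eq_coe, RingHom.coe_coe, expand_X, eval₂_pow]
      exact frobenius_teichmuller p _
  exact DFunLike.congr_fun this P

theorem red_frobLift (P : MvPolynomial σ (WittVector p k)) :
    red p (frobLift p P) = red p P ^ p := by
  rw [← teichHom_coeff_zero, ← frobenius_teichHom, WittVector.coeff_frobenius_charP,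
    teichHom_coeff_zero]

theorem p_mul_eq_verschiebung {R : Type*} [CommRing R] [CharP R p] (x : WittVector p R) :
    (p : WittVector p R) * x = WittVector.verschiebung (WittVector.frobenius x) := by
  rw [WittVector.verschiebung_frobenius, mul_comm]

/-- The terms of a^p are the p-th powers of the terms of a, and the lift of Frobenius sends [c] x^e
to [c^p] x^(pe). This gives F T(a) = T(a^p), which fails for a lift whose coefficients are not
Teichmüller. -/
theorem frobLift_polyLift (a : MvPolynomial σ k) :
    frobLift p (polyLift p a) = polyLift p (a ^ p) := by
  classical
  have hp : p ≠ 0 := (Fact.out : p.Prime).ne_zero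
  have ha : a ^ p = expand p (MvPolynomial.map (_root_.frobenius k p) a) := by
    induction a using MvPolynomial.induction_on' with
    | monomial e c =>
      rw [map_monomial, expand_monomial, monomial_pow]
      rfl
    | add a b h h' => rw [add_pow_char, h, h', map_add, map_add]
  rw [ha]
  ext1 e
  simp only [frobLift, RingHom.comp_apply, AlgHom.toRingHom_eq_coe, RingHom.coe_coe]
  rw [coeff_polyLift]
  by_cases he : ∃ e', p • e' = e
  · obtain ⟨e', rfl⟩ := he
    rw [coeff_expand_smul p hp, coeff_expand_smul p hp, coeff_map, coeff_map, coeff_polyLift,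
      frobenius_teichmuller, ← map_pow]
    rfl
  · have : ∃ i, ¬ p ∣ e i := by
      by_contra! h
      refine he ⟨e.mapRange (· / p) (Nat.zero_div p), Finsupp.ext fun i => ?_⟩
      simp [Nat.mul_div_cancel' (h i)]
    obtain ⟨i, hi⟩ := this
    rw [coeff_expand_of_not_dvd _ hi, coeff_expand_of_not_dvd _ hi,
      WittVector.teichmuller_zero]

theorem frobenius_teichSum (a : MvPolynomial σ k) :
    WittVector.frobenius (teichSum p a) = teichSum p (a ^ p) := by
  rw [teichSum, frobenius_teichHom, frobLift_polyLift, teichSum]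

variable [PerfectRing k p]

theorem exists_eq_p_mul {P : MvPolynomial σ (WittVector p k)} (h : red p P = 0) :
    ∃ Q, P = (p : MvPolynomial σ (WittVector p k)) * Q := by
  have : C (p : WittVector p k) ∣ P := by
    rw [C_dvd_iff_dvd_coeff]
    intro e
    rw [← Ideal.mem_span_singleton, WittVector.mem_span_p_iff_coeff_zero_eq_zero]
    have := congrArg (coeff e) h
    rwa [red, coeff_map, coeff_zero] at this
  obtain ⟨Q, hQ⟩ := this
  exact ⟨Q, by rw [hQ, map_natCast]⟩

theorem exists_teichHom_eq (P : MvPolynomial σ (WittVector p k)) :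
    ∃ Q, teichHom p P = teichSum p (red p P) +
      (p : WittVector p (MvPolynomial σ k)) * teichHom p Q := by
  obtain ⟨Q, hQ⟩ := exists_eq_p_mul p (P := P - polyLift p (red p P)) (by
    rw [map_sub, red_polyLift, sub_self])
  refine ⟨Q, ?_⟩
  rw [← map_natCast (teichHom (σ := σ) (k := k) p), ← map_mul, ← hQ, map_sub, teichSum]
  ring

/-- T is additive modulo p: the defect comes from a polynomial over W(k) with zero reduction, hence
a multiple of p because k is perfect. Writing p = VF puts the defect in the form that the
functionals below annihilate. -/
theorem exists_teichSum_add (a b : MvPolynomial σ k) :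
    ∃ γ, teichSum p a + teichSum p b =
      teichSum p (a + b) + WittVector.verschiebung (WittVector.frobenius γ) := by
  obtain ⟨Q, hQ⟩ := exists_teichHom_eq p (polyLift p a + polyLift p b)
  refine ⟨teichHom p Q, ?_⟩
  rw [map_add, map_add, red_polyLift, red_polyLift] at hQ
  rw [teichSum, teichSum, hQ, p_mul_eq_verschiebung]

end Teichmuller

/-! ### Functionals on Witt vectors over a polynomial ring -/

section Functional

variable {σ k : Type*} [Finite σ] [Field k] (p : ℕ) [Fact p.Prime] [CharP k p] [PerfectRing k p]

/-- The functional `∑ V^l(T(a_l)) ↦ ∑_{l < n} u^{m+l+1}(h_{m+l} a_l)` on `W(k[x])`, where `u` is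
the Cartier operator and `T(a)` is the sum of the Teichmüller lifts of the monomials of `a`. -/
def wittFunctional (h : ℕ → MvPolynomial σ k) :
    ℕ → ℕ → WittVector p (MvPolynomial σ k) → MvPolynomial σ k
  | 0, _, _ => 0
  | n + 1, m, α =>
    cartier p (m + 1) (h m * α.coeff 0) + wittFunctional h n (m + 1) (teichTail p α)

variable {h : ℕ → MvPolynomial σ k}

theorem wittFunctional_zero (n m : ℕ) : wittFunctional p h n m 0 = 0 := by
  induction n generalizing m with
  | zero => rfl
  | succ n ih =>
    have : teichTail p (0 : WittVector p (MvPolynomial σ k)) = 0 :=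
      teichTail_eq p (a := 0) (by rw [teichSum_zero, map_zero, add_zero])
    rw [wittFunctional, this, ih, WittVector.zero_coeff, mul_zero, map_zero, add_zero]

theorem wittFunctional_teichSum (n m : ℕ) (a : MvPolynomial σ k) :
    wittFunctional p h (n + 1) m (teichSum p a) = cartier p (m + 1) (h m * a) := by
  have : teichTail p (teichSum p a) = 0 :=
    teichTail_eq p (a := a) (by rw [map_zero, add_zero])
  rw [wittFunctional, this, wittFunctional_zero, teichSum_coeff_zero, add_zero]

theorem wittFunctional_verschiebung (n m : ℕ) (α : WittVector p (MvPolynomial σ k)) :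
    wittFunctional p h n m (WittVector.verschiebung α) = wittFunctional p h (n - 1) (m + 1) α := by
  cases n with
  | zero => rfl
  | succ n =>
    have : teichTail p (WittVector.verschiebung α) = α :=
      teichTail_eq p (a := 0) (by rw [teichSum_zero, zero_add])
    rw [wittFunctional, this, WittVector.verschiebung_coeff_zero, mul_zero, map_zero, zero_add,
      Nat.add_sub_cancel]

theorem wittFunctional_verschiebung_iterate (n m j : ℕ) (α : WittVector p (MvPolynomial σ k)) :
    wittFunctional p h n m (WittVector.verschiebung^[j] α) =
      wittFunctional p h (n - j) (m + j) α := by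
  induction j generalizing n m with
  | zero => rfl
  | succ j ih =>
    rw [Function.iterate_succ_apply', wittFunctional_verschiebung, ih]
    congr 1 <;> omega

/-- F commutes with V and F T(a) = T(a^p), so only values u^(m+1)(h_m a^p) = u^m(a u(h_m)) occur,
and u(h_m) = 0. Starting at m ≥ 1 means that the functional started at 0 kills VF = p. -/
theorem wittFunctional_frobenius (hh : ∀ j, 1 ≤ j → cartier p 1 (h j) = 0) (n m : ℕ)
    (hm : 1 ≤ m) (β : WittVector p (MvPolynomial σ k)) :
    wittFunctional p h n m (WittVector.frobenius β) = 0 := by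
  induction n generalizing m β with
  | zero => rfl
  | succ n ih =>
    have h1 : teichTail p (WittVector.frobenius β) = WittVector.frobenius (teichTail p β) := by
      apply teichTail_eq p (a := β.coeff 0 ^ p)
      conv_lhs => rw [teichSum_add_teichTail p β]
      rw [map_add, frobenius_teichSum, WittVector.frobenius_verschiebung,
        WittVector.verschiebung_frobenius]
    rw [wittFunctional, h1, ih (m + 1) (by omega), WittVector.coeff_frobenius_charP, add_zero,
      ← cartier_cartier, mul_comm, cartier_one_pow_mul, hh m hm, mul_zero, map_zero]

/-- The failure of additivity of T is some VFγ, which enters the tail as Fγ at level m + 1 ≥ 1 and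
is killed there. -/
theorem wittFunctional_add (hh : ∀ j, 1 ≤ j → cartier p 1 (h j) = 0) (n m : ℕ)
    (α β : WittVector p (MvPolynomial σ k)) :
    wittFunctional p h n m (α + β) = wittFunctional p h n m α + wittFunctional p h n m β := by
  induction n generalizing m α β with
  | zero => simp [wittFunctional]
  | succ n ih =>
    obtain ⟨γ, hγ⟩ := exists_teichSum_add p (α.coeff 0) (β.coeff 0)
    have h0 : (α + β).coeff 0 = α.coeff 0 + β.coeff 0 :=
      map_add (WittVector.constantCoeff : WittVector p (MvPolynomial σ k) →+* _) α β
    have h1 : teichTail p (α + β) =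
        teichTail p α + teichTail p β + WittVector.frobenius γ := by
      apply teichTail_eq p (a := α.coeff 0 + β.coeff 0)
      conv_lhs => rw [teichSum_add_teichTail p α, teichSum_add_teichTail p β]
      rw [add_add_add_comm, hγ, map_add, map_add]
      ring
    rw [wittFunctional, wittFunctional, wittFunctional, h1, ih, ih,
      wittFunctional_frobenius p hh n (m + 1) (by omega), h0, mul_add, map_add]
    ring

/-- T is multiplicative when one factor is a single term. Moving [M]^(p^(m+1)) inside V raises it to
the p-th power, which matches the extra Cartier operator applied one level further. -/
theorem wittFunctional_monomial_pow_mul (n m : ℕ) (e : σ →₀ ℕ) (c : k)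
    (α : WittVector p (MvPolynomial σ k)) :
    wittFunctional p h n m (WittVector.teichmuller p (monomial e c) ^ p ^ (m + 1) * α) =
      monomial e c * wittFunctional p h n m α := by
  induction n generalizing m α with
  | zero => simp [wittFunctional]
  | succ n ih =>
    set M : MvPolynomial σ k := monomial e c with hM
    have hpow : M ^ p ^ (m + 1) = monomial (p ^ (m + 1) • e) (c ^ p ^ (m + 1)) := by
      rw [hM, monomial_pow]
    have h0 : (WittVector.teichmuller p M ^ p ^ (m + 1) * α).coeff 0 =
        M ^ p ^ (m + 1) * α.coeff 0 := by
      rw [← map_pow, WittVector.mul_coeff_zero, WittVector.teichmuller_coeff_zero]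
    have h1 : teichTail p (WittVector.teichmuller p M ^ p ^ (m + 1) * α) =
        WittVector.teichmuller p M ^ p ^ (m + 1 + 1) * teichTail p α := by
      apply teichTail_eq p (a := M ^ p ^ (m + 1) * α.coeff 0)
      conv_lhs => rw [teichSum_add_teichTail p α]
      rw [mul_add, hpow, teichSum_monomial_mul, ← hpow, map_pow]
      congr 1
      rw [mul_comm, ← WittVector.verschiebung_mul_frobenius, map_pow, frobenius_teichmuller,
        ← pow_mul, ← pow_succ', mul_comm]
    rw [wittFunctional, wittFunctional, h0, h1, ih, mul_left_comm, cartier_pow_mul, mul_add]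

/-- The functional of `wittFunctional` as an additive map. -/
def wittFunctionalHom (hh : ∀ j, 1 ≤ j → cartier p 1 (h j) = 0) (n : ℕ) :
    WittVector p (MvPolynomial σ k) →+ MvPolynomial σ k where
  toFun := wittFunctional p h n 0
  map_zero' := wittFunctional_zero p n 0
  map_add' := wittFunctional_add p hh n 0

theorem wittFunctionalHom_p_mul (hh : ∀ j, 1 ≤ j → cartier p 1 (h j) = 0) (n : ℕ)
    (α : WittVector p (MvPolynomial σ k)) :
    wittFunctionalHom p hh n ((p : WittVector p (MvPolynomial σ k)) * α) = 0 := by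
  rw [p_mul_eq_verschiebung]
  refine (wittFunctional_verschiebung p n 0 _).trans ?_
  exact wittFunctional_frobenius p hh _ _ le_rfl _

theorem wittFunctionalHom_verschiebung_teichSum (hh : ∀ j, 1 ≤ j → cartier p 1 (h j) = 0)
    {n j : ℕ} (hj : j < n) (a : MvPolynomial σ k) :
    wittFunctionalHom p hh n (WittVector.verschiebung^[j] (teichSum p a)) =
      cartier p (j + 1) (h j * a) := by
  refine (wittFunctional_verschiebung_iterate p n 0 j _).trans ?_
  obtain ⟨i, hi⟩ : ∃ i, n - j = i + 1 := ⟨n - j - 1, by omega⟩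
  rw [hi, wittFunctional_teichSum, zero_add]

theorem wittFunctionalHom_verschiebung (hh : ∀ j, 1 ≤ j → cartier p 1 (h j) = 0)
    {n j : ℕ} (hj : n ≤ j) (α : WittVector p (MvPolynomial σ k)) :
    wittFunctionalHom p hh n (WittVector.verschiebung^[j] α) = 0 := by
  refine (wittFunctional_verschiebung_iterate p n 0 j _).trans ?_
  rw [Nat.sub_eq_zero_of_le hj]
  rfl

/-- As FV = p is killed, w may be replaced by T(w_0). Additivity of T modulo p then reduces the
claim to a single term. -/
theorem wittFunctionalHom_frobenius_mul (hh : ∀ j, 1 ≤ j → cartier p 1 (h j) = 0) (n : ℕ)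
    (w α : WittVector p (MvPolynomial σ k)) :
    wittFunctionalHom p hh n (WittVector.frobenius w * α) =
      w.coeff 0 * wittFunctionalHom p hh n α := by
  have h1 : ∀ a : MvPolynomial σ k,
      wittFunctionalHom p hh n (WittVector.frobenius (teichSum p a) * α) =
        a * wittFunctionalHom p hh n α := by
    intro a
    induction a using MvPolynomial.induction_on' with
    | monomial e c =>
      rw [teichSum_monomial, frobenius_teichmuller]
      have := wittFunctional_monomial_pow_mul p (h := h) n 0 e c α
      rwa [zero_add, pow_one] at this
    | add a b ha hb =>
      obtain ⟨γ, hγ⟩ := exists_teichSum_add p a b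
      have h2 := congrArg
        (fun x => wittFunctionalHom p hh n (WittVector.frobenius x * α)) hγ
      simp only [map_add, add_mul] at h2
      rw [ha, hb, WittVector.frobenius_verschiebung, mul_comm (WittVector.frobenius γ), mul_assoc,
        wittFunctionalHom_p_mul, add_zero] at h2
      rw [← h2, add_mul]
  conv_lhs => rw [teichSum_add_teichTail p w]
  rw [map_add, add_mul, map_add, h1, WittVector.frobenius_verschiebung, mul_comm (teichTail p w),
    mul_assoc, wittFunctionalHom_p_mul, add_zero]

end Functional

/-! ### The Teichmüller expansion of the Teichmüller lift of a polynomial -/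

section Expansion

variable {σ k : Type*} [Field k] (p : ℕ) [Fact p.Prime]

theorem exists_verschiebung_eq {R : Type*} [CommRing R] {x : WittVector p R} (h : x.coeff 0 = 0) :
    ∃ y, x = WittVector.verschiebung y := by
  exact ⟨_, WittVector.eq_iterate_verschiebung (x := x) (n := 1) (by
    intro i hi
    obtain rfl : i = 0 := by omega
    exact h)⟩

/-- The point is V(z)^2 = p V(z^2), from V(z) V(z) = V(z FV(z)) and FV = p; the remaining p - 2
factors are kept. -/
theorem exists_pow_eq_p_mul {R : Type*} [CommRing R] [CharP R p] {x : WittVector p R}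
    (h : x.coeff 0 = 0) :
    ∃ y : WittVector p R, y.coeff 0 = 0 ∧ x ^ p = p * y := by
  obtain ⟨z, rfl⟩ := exists_verschiebung_eq p h
  have hp2 : 2 ≤ p := (Fact.out : p.Prime).two_le
  refine ⟨WittVector.verschiebung (z * z) * WittVector.verschiebung z ^ (p - 2), ?_, ?_⟩
  · rw [WittVector.mul_coeff_zero, WittVector.verschiebung_coeff_zero, zero_mul]
  · have h1 : WittVector.verschiebung z * WittVector.verschiebung z =
        p * WittVector.verschiebung (z * z) := by
      rw [← WittVector.verschiebung_mul_frobenius, WittVector.frobenius_verschiebung, ← mul_assoc,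
        mul_comm (z * z), ← nsmul_eq_mul, map_nsmul, nsmul_eq_mul]
    rw [← mul_assoc, ← h1, ← pow_two, ← pow_add]
    congr 1
    omega

/-- A refinement of the usual congruence of p^m-th powers: here x ≡ y only modulo V W(R), which may
be larger than (p), and the quotient z by p^m stays in V W(R) because z^p is p times an element of V
W(R). -/
theorem exists_pow_prime_pow_eq {R : Type*} [CommRing R] [CharP R p] {x y : WittVector p R}
    (h : x.coeff 0 = y.coeff 0) (m : ℕ) :
    ∃ z : WittVector p R, z.coeff 0 = 0 ∧ x ^ p ^ m = y ^ p ^ m + p ^ m * z := by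
  induction m with
  | zero =>
    refine ⟨x - y, ?_, by simp⟩
    have := map_sub (WittVector.constantCoeff : WittVector p R →+* R) x y
    simpa [WittVector.constantCoeff_apply, h] using this
  | succ m ih =>
    obtain ⟨z, hz, hxy⟩ := ih
    obtain ⟨w, hw, hzw⟩ := exists_pow_eq_p_mul p hz
    obtain ⟨r, hr⟩ := exists_add_pow_prime_eq (Fact.out : p.Prime) (y ^ p ^ m) ((p : WittVector p R) ^ m * z)
    refine ⟨(p : WittVector p R) ^ (m * (p - 1)) * w + y ^ p ^ m * z * r, ?_, ?_⟩
    · have := map_add (WittVector.constantCoeff : WittVector p R →+* R)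
        ((p : WittVector p R) ^ (m * (p - 1)) * w) (y ^ p ^ m * z * r)
      simpa only [WittVector.constantCoeff_apply, WittVector.mul_coeff_zero, hz, hw, mul_zero,
        zero_mul, add_zero] using this
    · have h1 : m * p = m + m * (p - 1) := by
        obtain ⟨c, hc⟩ := Nat.exists_eq_add_of_lt (Fact.out : p.Prime).pos
        rw [hc]
        simp only [zero_add, Nat.add_sub_cancel]
        ring
      rw [pow_succ p m, pow_mul, hxy, hr, pow_mul y, mul_pow, hzw,
        ← pow_mul (p : WittVector p R), h1, pow_add]
      ring

variable [CharP k p]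

theorem frobenius_iterate_teichHom (l : ℕ) (P : MvPolynomial σ (WittVector p k)) :
    WittVector.frobenius^[l] (teichHom p P) = teichHom p ((frobLift p)^[l] P) := by
  induction l with
  | zero => rfl
  | succ l ih => rw [Function.iterate_succ_apply', ih, frobenius_teichHom,
      Function.iterate_succ_apply']

theorem red_frobLift_iterate (l : ℕ) (P : MvPolynomial σ (WittVector p k)) :
    red p ((frobLift p)^[l] P) = red p P ^ p ^ l := by
  induction l with
  | zero => simp
  | succ l ih => rw [Function.iterate_succ_apply', red_frobLift, ih, ← pow_mul, ← pow_succ]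

/-- F^m is injective, so it suffices to compare images. On the left F^m[f] = [f]^(p^m), which
differs from T(f)^(p^m) by a multiple of p^m = F^m V^m. On the right F^m V^l = p^l F^(m-l), and the
sum telescopes to the image of L^(p^m), where L is the Teichmüller lift of f. -/
theorem exists_teichmuller_expansion (f : MvPolynomial σ k)
    {η : ℕ → MvPolynomial σ (WittVector p k)} (h0 : η 0 = polyLift p f)
    (h : ∀ l, polyLift p f ^ p ^ (l + 1) = frobLift p (polyLift p f ^ p ^ l) +
        (p : MvPolynomial σ (WittVector p k)) ^ (l + 1) * η (l + 1)) (m : ℕ) :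
    ∃ β, WittVector.teichmuller p f =
      (∑ l ∈ Finset.range (m + 1), WittVector.verschiebung^[l] (teichHom p (η l))) +
        WittVector.verschiebung^[m] β := by
  have hFV : ∀ (l : ℕ) (x : WittVector p (MvPolynomial σ k)),
      WittVector.frobenius^[l] (WittVector.verschiebung^[l] x) = p ^ l * x := by
    intro l
    induction l with
    | zero => simp
    | succ l ih =>
      intro x
      rw [Function.iterate_succ_apply, Function.iterate_succ_apply',
        WittVector.frobenius_verschiebung, ← RingHom.coe_pow, map_mul, map_natCast,
        RingHom.coe_pow, ih]
      ring
  have h1 : ∀ m, WittVector.frobenius^[m] (∑ l ∈ Finset.range (m + 1),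
      WittVector.verschiebung^[l] (teichHom p (η l))) = teichHom p (polyLift p f ^ p ^ m) := by
    intro m
    induction m with
    | zero => simp [h0]
    | succ m ih =>
      rw [Finset.sum_range_succ, ← RingHom.coe_pow, map_add, RingHom.coe_pow, hFV,
        Function.iterate_succ_apply', ih, frobenius_teichHom, h, map_add, map_mul,
        map_pow (teichHom p) (p : MvPolynomial σ (WittVector p k)), map_natCast]
  obtain ⟨z, -, hz⟩ := exists_pow_prime_pow_eq p (x := WittVector.teichmuller p f)
    (y := teichSum p f) (by rw [teichSum_coeff_zero, WittVector.teichmuller_coeff_zero]) m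
  have h2 : ∀ m, WittVector.frobenius^[m] (WittVector.teichmuller p f) =
      WittVector.teichmuller p f ^ p ^ m := by
    intro m
    induction m with
    | zero => simp
    | succ m ih =>
      rw [Function.iterate_succ_apply', ih, map_pow, frobenius_teichmuller, ← pow_mul,
        ← pow_succ']
  have hinj : Function.Injective (WittVector.frobenius :
      WittVector p (MvPolynomial σ k) → WittVector p (MvPolynomial σ k)) := by
    intro x y hxy
    ext1 i
    have := congrArg (fun w => WittVector.coeff w i) hxy
    simp only [WittVector.coeff_frobenius_charP] at this
    exact frobenius_inj (MvPolynomial σ k) p this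
  refine ⟨z, (hinj.iterate m) ?_⟩
  rw [h2, hz, ← RingHom.coe_pow, map_add, RingHom.coe_pow, h1, hFV, map_pow, teichSum]

variable [PerfectRing k p]

/-- The `p`-adic expansion of the powers `L ^ p ^ l` of the Teichmüller lift `L` of `f` along the
lift of Frobenius. -/
theorem exists_expansion (f : MvPolynomial σ k) :
    ∃ η : ℕ → MvPolynomial σ (WittVector p k), η 0 = polyLift p f ∧
      (∀ l, polyLift p f ^ p ^ (l + 1) = frobLift p (polyLift p f ^ p ^ l) +
        (p : MvPolynomial σ (WittVector p k)) ^ (l + 1) * η (l + 1)) ∧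
      ∀ l, ∃ g a, red p (η (l + 2)) = f ^ 2 * g + a ^ p := by
  set L := polyLift p f with hL
  have hp := (Fact.out : p.Prime)
  have h1 : ∃ η, L ^ p = frobLift p L + (p : MvPolynomial σ (WittVector p k)) * η := by
    obtain ⟨η, hη⟩ := exists_eq_p_mul p (P := L ^ p - frobLift p L) (by
      rw [map_sub, map_pow, red_frobLift, sub_self])
    exact ⟨η, by rw [← hη]; ring⟩
  obtain ⟨η₁, hη₁⟩ := h1
  have step : ∀ (l : ℕ) (η : MvPolynomial σ (WittVector p k)),
      L ^ p ^ (l + 1) = frobLift p (L ^ p ^ l) +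
        (p : MvPolynomial σ (WittVector p k)) ^ (l + 1) * η →
      ∃ η', L ^ p ^ (l + 2) = frobLift p (L ^ p ^ (l + 1)) +
        (p : MvPolynomial σ (WittVector p k)) ^ (l + 2) * η' ∧
        ∃ g a, red p η' = f ^ 2 * g + a ^ p := by
    intro l η hη
    obtain ⟨r, hr⟩ := exists_add_pow_prime_eq hp (frobLift p (L ^ p ^ l))
      ((p : MvPolynomial σ (WittVector p k)) ^ (l + 1) * η)
    obtain ⟨c, hc⟩ : ∃ c, (l + 1) * p = l + 2 + c := by
      have : (l + 1) * 2 ≤ (l + 1) * p := Nat.mul_le_mul_left _ hp.two_le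
      exact ⟨(l + 1) * p - (l + 2), by omega⟩
    refine ⟨(p : MvPolynomial σ (WittVector p k)) ^ c * η ^ p +
      frobLift p (L ^ p ^ l) * η * r, ?_, ?_⟩
    · have h2 : frobLift p (L ^ p ^ (l + 1)) = frobLift p (L ^ p ^ l) ^ p := by
        rw [← map_pow, ← pow_mul, ← pow_succ]
      rw [h2, pow_succ p (l + 1), pow_mul, hη, hr, mul_pow,
        ← pow_mul (p : MvPolynomial σ (WittVector p k)), hc, pow_add]
      ring
    · obtain ⟨d, hd⟩ : ∃ d, p ^ (l + 1) = 2 + d := by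
        have : p ≤ p ^ (l + 1) := Nat.le_self_pow (by omega) p
        have := hp.two_le
        exact ⟨p ^ (l + 1) - 2, by omega⟩
      -- The term p^c η^p survives reduction only if c = 0, that is for p = 2 and l = 0, and then it
      -- is a p-th power. The other term contains the reduction f^(p^(l+1)) of φ(L^(p^l)), hence
      -- f^2.
      refine ⟨f ^ d * red p η * red p r, if c = 0 then red p η else 0, ?_⟩
      rw [map_add, map_mul, map_mul, map_mul, red_frobLift, map_pow, map_pow, map_pow, hL,
        red_polyLift, ← pow_mul, ← pow_succ, hd, map_natCast, CharP.cast_eq_zero]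
      split_ifs with hc0
      · rw [hc0]; ring
      · rw [zero_pow hc0, zero_pow hp.ne_zero]; ring
  choose! next hnext using step
  let η : ℕ → MvPolynomial σ (WittVector p k) := fun l =>
    Nat.casesOn l L fun l' => Nat.rec η₁ (fun i x => next i x) l'
  have hη : ∀ l, L ^ p ^ (l + 1) = frobLift p (L ^ p ^ l) +
      (p : MvPolynomial σ (WittVector p k)) ^ (l + 1) * η (l + 1) := by
    intro l
    induction l with
    | zero =>
      rw [zero_add, pow_one, pow_one, pow_zero, pow_one]
      exact hη₁
    | succ l ih => exact (hnext l _ ih).1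
  exact ⟨η, rfl, hη, fun l => (hnext l _ (hη l)).2⟩

end Expansion

/-! ### Values of functionals on the Witt vectors of a principal ideal -/

section Values

variable {σ k : Type*} [Finite σ] [Field k] (p : ℕ) [Fact p.Prime] [CharP k p] [PerfectRing k p]
  {f : MvPolynomial σ k} {n : ℕ}

theorem verschiebung_iterate_add {R : Type*} [CommRing R] (j : ℕ) (x y : WittVector p R) :
    WittVector.verschiebung^[j] (x + y) =
      WittVector.verschiebung^[j] x + WittVector.verschiebung^[j] y := by
  exact iterate_map_add _ j x y

theorem verschiebung_iterate_sum {R ι : Type*} [CommRing R] (j : ℕ) (s : Finset ι)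
    (x : ι → WittVector p R) :
    WittVector.verschiebung^[j] (∑ i ∈ s, x i) = ∑ i ∈ s, WittVector.verschiebung^[j] (x i) := by
  let V : WittVector p R →+ WittVector p R :=
    ⟨⟨WittVector.verschiebung^[j], iterate_map_zero _ j⟩, verschiebung_iterate_add p j⟩
  exact map_sum V x s

theorem verschiebung_iterate_p_mul {R : Type*} [CommRing R] (j : ℕ) (x : WittVector p R) :
    WittVector.verschiebung^[j] ((p : WittVector p R) * x) =
      p * WittVector.verschiebung^[j] x := by
  let V : WittVector p R →+ WittVector p R :=
    ⟨⟨WittVector.verschiebung^[j], iterate_map_zero _ j⟩, verschiebung_iterate_add p j⟩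
  have := map_nsmul V p x
  rwa [nsmul_eq_mul, nsmul_eq_mul] at this

/-- `χ` is, modulo `f`, the functional on `W_n(k[x])` given by the family `h`. -/
structure IsReprBy (n : ℕ) (f : MvPolynomial σ k)
    (χ : WittVector p (MvPolynomial σ k) →+ MvPolynomial σ k ⧸ Ideal.span {f})
    (h : ℕ → MvPolynomial σ k) : Prop where
  map_verschiebung : ∀ j, n ≤ j → ∀ α, χ (WittVector.verschiebung^[j] α) = 0
  map_p_mul : ∀ α, χ ((p : WittVector p (MvPolynomial σ k)) * α) = 0
  map_teichSum : ∀ j, j < n → ∀ a, χ (WittVector.verschiebung^[j] (teichSum p a)) =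
    Ideal.Quotient.mk _ (cartier p (j + 1) (h j * a))

theorem mk_span_eq_zero_iff {R : Type*} [CommRing R] {f a : R} :
    Ideal.Quotient.mk (Ideal.span {f}) a = 0 ↔ f ∣ a := by
  rw [Ideal.Quotient.eq_zero_iff_mem, Ideal.mem_span_singleton]

theorem IsReprBy.map_teichHom {χ : WittVector p (MvPolynomial σ k) →+ MvPolynomial σ k ⧸ Ideal.span {f}}
    {h : ℕ → MvPolynomial σ k} (H : IsReprBy p n f χ h) {j : ℕ} (hj : j < n)
    (P : MvPolynomial σ (WittVector p k)) :
    χ (WittVector.verschiebung^[j] (teichHom p P)) =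
      Ideal.Quotient.mk _ (cartier p (j + 1) (h j * red p P)) := by
  obtain ⟨Q, hQ⟩ := exists_teichHom_eq p P
  rw [hQ, verschiebung_iterate_add, map_add, verschiebung_iterate_p_mul, H.map_p_mul, add_zero,
    H.map_teichSum j hj]

/-- The values of a functional on `V^j([f] s(B))`. -/
theorem IsReprBy.map_teichmuller_mul
    {χ : WittVector p (MvPolynomial σ k) →+ MvPolynomial σ k ⧸ Ideal.span {f}}
    {h : ℕ → MvPolynomial σ k} (H : IsReprBy p n f χ h)
    {η : ℕ → MvPolynomial σ (WittVector p k)} (h0 : η 0 = polyLift p f)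
    (hη : ∀ l, polyLift p f ^ p ^ (l + 1) = frobLift p (polyLift p f ^ p ^ l) +
        (p : MvPolynomial σ (WittVector p k)) ^ (l + 1) * η (l + 1))
    (hη' : ∀ l, ∃ g a, red p (η (l + 2)) = f ^ 2 * g + a ^ p)
    {j : ℕ} (hj : j + 1 < n)
    (hu : ∀ i, 1 ≤ i → i < n → f ^ p ^ i ∣ cartier p 1 (h i))
    (hh : ∀ i, j < i → i < n → f ^ (p ^ (i + 1) - 2) ∣ h i)
    (B : MvPolynomial σ (WittVector p k)) :
    χ (WittVector.verschiebung^[j] (WittVector.teichmuller p f * teichHom p B)) =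
      Ideal.Quotient.mk _
        (cartier p (j + 1) ((f * h j + cartier p 1 (h (j + 1) * red p (η 1))) * red p B)) := by
  obtain ⟨β, hβ⟩ := exists_teichmuller_expansion p f h0 hη (n + 1)
  have hp := (Fact.out : p.Prime)
  have hterm : ∀ (l : ℕ) (x : WittVector p (MvPolynomial σ k)), WittVector.verschiebung^[j]
      (WittVector.verschiebung^[l] x * teichHom p B) =
      WittVector.verschiebung^[j + l] (x * teichHom p ((frobLift p)^[l] B)) := by
    intro l x
    rw [WittVector.iterate_verschiebung_mul_left, ← Function.iterate_add_apply,
      frobenius_iterate_teichHom]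
  rw [hβ, add_mul, verschiebung_iterate_add, map_add, hterm,
    H.map_verschiebung (j + (n + 1)) (by omega), add_zero, Finset.sum_mul, verschiebung_iterate_sum, map_sum]
  simp only [hterm, ← map_mul]
  rw [Finset.sum_range_succ', Finset.sum_range_succ', Finset.sum_eq_zero]
  · rw [H.map_teichHom p (by omega), H.map_teichHom p (by omega), map_mul (red p), map_mul (red p),
      red_frobLift_iterate, red_frobLift_iterate, h0, red_polyLift, zero_add, ← map_add]
    congr 1
    rw [add_mul, map_add, add_comm]
    congr 1
    · simp only [add_zero, pow_zero, pow_one]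
      congr 1
      ring
    · simp only [zero_add, pow_one]
      rw [← cartier_cartier, ← mul_assoc]
      congr 1
      simpa [mul_comm] using cartier_mul_pow p 1 (h (j + 1) * red p (η 1)) (red p B)
  · intro l _
    -- Only the terms of index 0 and 1 of the expansion contribute. Beyond them, with i = j + l + 2,
    -- the part f^2 g completes the factor f^(p^(i+1) - 2) of h_i to f^(p^(i+1)), and the p-th power
    -- part is handled by u(h_i a^p) = a u(h_i), which is divisible by f^(p^i).
    by_cases hl : j + (l + 2) < n
    · rw [show l + 1 + 1 = l + 2 from rfl, H.map_teichHom p hl, map_mul (red p), red_frobLift_iterate,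
        show j + (l + 2) + 1 = (j + 1) + (l + 2) by ring, ← cartier_cartier, ← mul_assoc,
        cartier_mul_pow, mk_span_eq_zero_iff]
      apply dvd_cartier_of_pow_dvd
      apply Dvd.dvd.mul_left
      obtain ⟨g, a, hga⟩ := hη' l
      rw [hga, mul_add, map_add]
      apply dvd_add
      · apply dvd_cartier_of_pow_dvd
        rw [← pow_mul, ← pow_add, ← mul_assoc]
        apply Dvd.dvd.mul_right
        have h2 : 2 ≤ p ^ (j + (l + 2) + 1) :=
          hp.two_le.trans (Nat.le_self_pow (by omega) p)
        have : p ^ (j + 1 + (l + 2)) = p ^ (j + (l + 2) + 1) - 2 + 2 := by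
          rw [Nat.sub_add_cancel h2]
          congr 1
          ring
        rw [this, pow_add]
        exact mul_dvd_mul_right (hh _ (by omega) hl) _
      · have : cartier p (l + 2) (h (j + (l + 2)) * a ^ p) =
            cartier p (l + 1) (a * cartier p 1 (h (j + (l + 2)))) := by
          rw [show l + 2 = (l + 1) + 1 from rfl, ← cartier_cartier]
          congr 1
          simpa using cartier_mul_pow p 1 (h (j + (l + 1 + 1))) a
        rw [this]
        apply dvd_cartier_of_pow_dvd
        apply Dvd.dvd.mul_left
        rw [← pow_mul, ← pow_add]
        have := hu (j + (l + 2)) (by omega) hl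
        rwa [show j + 1 + (l + 1) = j + (l + 2) by ring]
    · exact H.map_verschiebung _ (by omega) _

end Values

/-! ### Splitting functionals and chains of polynomials -/

section Chains

variable {σ k : Type*} [Field k] (p : ℕ) [Fact p.Prime] [CharP k p] [PerfectRing k p]

/-- The polynomials of `exists_expansion`. -/
def expansion (f : MvPolynomial σ k) : ℕ → MvPolynomial σ (WittVector p k) :=
  (exists_expansion p f).choose

theorem expansion_zero (f : MvPolynomial σ k) : expansion p f 0 = polyLift p f :=
  (exists_expansion p f).choose_spec.1

theorem expansion_succ (f : MvPolynomial σ k) (l : ℕ) :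
    polyLift p f ^ p ^ (l + 1) = frobLift p (polyLift p f ^ p ^ l) +
      (p : MvPolynomial σ (WittVector p k)) ^ (l + 1) * expansion p f (l + 1) :=
  (exists_expansion p f).choose_spec.2.1 l

theorem expansion_add_two (f : MvPolynomial σ k) (l : ℕ) :
    ∃ g a, red p (expansion p f (l + 2)) = f ^ 2 * g + a ^ p :=
  (exists_expansion p f).choose_spec.2.2 l

/-- The polynomial `Δ(f)`: the reduction of `(L ^ p - φ(L)) / p`, where `L` is the Teichmüller
lift of `f` and `φ` is the lift of Frobenius. -/
def polyDelta (f : MvPolynomial σ k) : MvPolynomial σ k := red p (expansion p f 1)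

variable [Finite σ]

/-- A functional modulo `f` on the Witt vectors of length `n` over `k[x]` which splits Frobenius
and vanishes on the Witt vectors with components in `(f), …, (f), (f ^ r)`. -/
structure IsSplitting (n r : ℕ) (f : MvPolynomial σ k)
    (χ : WittVector p (MvPolynomial σ k) →+ MvPolynomial σ k ⧸ Ideal.span {f}) : Prop where
  frobenius_mul : ∀ w α, χ (WittVector.frobenius w * α) =
    Ideal.Quotient.mk _ (w.coeff 0) * χ α
  map_verschiebung : ∀ j, n ≤ j → ∀ α, χ (WittVector.verschiebung^[j] α) = 0
  apply_one : χ 1 = 1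
  apply_mul : ∀ j b, j + 1 < n →
    χ (WittVector.verschiebung^[j] (WittVector.teichmuller p (f * b))) = 0
  apply_pow_mul : ∀ j b, j + 1 = n →
    χ (WittVector.verschiebung^[j] (WittVector.teichmuller p (f ^ r * b))) = 0

variable {p} {n r : ℕ} {f : MvPolynomial σ k}
  {χ : WittVector p (MvPolynomial σ k) →+ MvPolynomial σ k ⧸ Ideal.span {f}}

theorem IsSplitting.map_p_mul (S : IsSplitting p n r f χ) (α : WittVector p (MvPolynomial σ k)) :
    χ ((p : WittVector p (MvPolynomial σ k)) * α) = 0 := by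
  have := S.frobenius_mul (p : WittVector p (MvPolynomial σ k)) α
  rwa [map_natCast, WittVector.coeff_p_zero, map_zero, zero_mul] at this

/-- Linearity through F gives χ(V^j [y^(p^(j+1)) x^r]) = y χ(V^j [x^r]), so χ is determined at level
j by its values on the x^r with r < p^(j+1). Lifts of these values are interpolated by h_j through
the dual basis for u^(j+1). -/
theorem IsSplitting.exists_isReprBy (S : IsSplitting p n r f χ) : ∃ h, IsReprBy p n f χ h := by
  classical
  have := Fintype.ofFinite σ
  choose g hg using fun (j : ℕ) (r : σ → Fin (p ^ (j + 1))) =>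
    Ideal.Quotient.mk_surjective (I := Ideal.span {f}) (χ (WittVector.verschiebung^[j]
      (WittVector.teichmuller p (monomial (smallExp p (j + 1) r) (1 : k)))))
  refine ⟨fun j => ∑ r', g j r' ^ p ^ (j + 1) * monomial (smallExpCompl p (j + 1) r') 1,
    S.map_verschiebung, S.map_p_mul, fun j hj a => ?_⟩
  induction a using MvPolynomial.induction_on' with
  | monomial e c =>
    obtain ⟨s, r, rfl⟩ := exists_eq_smul_add_smallExp p (j + 1) e
    have h1 : monomial (p ^ (j + 1) • s + smallExp p (j + 1) r) c =
        monomial s (root p (j + 1) c) ^ p ^ (j + 1) * monomial (smallExp p (j + 1) r) 1 := by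
      rw [monomial_pow, pow_root, monomial_mul, mul_one]
    have h2 : ∀ (y : MvPolynomial σ k) (i : ℕ),
        WittVector.frobenius^[i] (WittVector.teichmuller p y) =
          WittVector.teichmuller p (y ^ p ^ i) := by
      intro y i
      induction i with
      | zero => simp
      | succ i ih => rw [Function.iterate_succ_apply', ih, frobenius_teichmuller, ← map_pow,
          ← pow_mul, ← pow_succ]
    rw [teichSum_monomial, h1, map_mul, ← h2, mul_comm (WittVector.frobenius^[j + 1] _),
      Function.iterate_succ_apply, ← WittVector.iterate_verschiebung_mul_left, mul_comm,
      S.frobenius_mul, WittVector.teichmuller_coeff_zero, ← hg, ← map_mul]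
    congr 1
    rw [mul_left_comm, cartier_pow_mul, cartier_sum_mul]
  | add a b ha hb =>
    obtain ⟨γ, hγ⟩ := exists_teichSum_add p a b
    have h1 : teichSum p (a + b) = teichSum p a + (teichSum p b + (p : WittVector p _) * (-γ)) := by
      rw [← add_assoc, hγ, ← p_mul_eq_verschiebung]
      ring
    rw [h1, verschiebung_iterate_add, verschiebung_iterate_add, verschiebung_iterate_p_mul,
      map_add, map_add, S.map_p_mul, ha, hb, add_zero, mul_add, map_add, map_add]

theorem IsReprBy.map_verschiebung_teichmuller {h : ℕ → MvPolynomial σ k} {m : ℕ}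
    (H : IsReprBy p (m + 1) f χ h) (b : MvPolynomial σ k) :
    χ (WittVector.verschiebung^[m] (WittVector.teichmuller p b)) =
      Ideal.Quotient.mk _ (cartier p (m + 1) (h m * b)) := by
  rw [teichSum_add_teichTail p (WittVector.teichmuller p b), verschiebung_iterate_add, map_add,
    ← Function.iterate_succ_apply, H.map_verschiebung _ le_rfl, add_zero,
    WittVector.teichmuller_coeff_zero, H.map_teichSum _ (Nat.lt_succ_self m)]

/-- χ kills V^i T(a^p) = p V^(i-1) T(a), which says that f divides u^i(a u(h_i)) for every monomial
a; duality for u^i turns this into divisibility of u(h_i). -/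
theorem IsReprBy.pow_dvd_cartier {h : ℕ → MvPolynomial σ k} (H : IsReprBy p n f χ h)
    {i : ℕ} (h1 : 1 ≤ i) (hi : i < n) : f ^ p ^ i ∣ cartier p 1 (h i) := by
  classical
  have := Fintype.ofFinite σ
  refine pow_dvd_of_dvd_cartier p i fun e => ?_
  obtain ⟨l, rfl⟩ : ∃ l, i = l + 1 := ⟨i - 1, by omega⟩
  have h2 := cartier_mul_pow p 1 (h (l + 1)) (monomial e 1)
  rw [pow_one] at h2
  rw [mul_comm, ← h2, cartier_cartier, ← mk_span_eq_zero_iff, ← H.map_teichSum (l + 1) hi,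
    ← frobenius_teichSum, Function.iterate_succ_apply, ← p_mul_eq_verschiebung,
    verschiebung_iterate_p_mul, H.map_p_mul]

/-- This uses p^(i+1) - 2 = p(p^i - 1) + (p - 2). The exponent drops from p^(i+1) - 2 to p^i - 1,
one more than the p^i - 2 of the preceding level. -/
theorem cartier_pow_sub_two_mul (i : ℕ) (f a : MvPolynomial σ k) :
    cartier p 1 (f ^ (p ^ (i + 1) - 2) * a) =
      f ^ (p ^ i - 1) * cartier p 1 (f ^ (p - 2) * a) := by
  have hp := (Fact.out : p.Prime).two_le
  rw [← cartier_one_pow_mul, ← mul_assoc, ← pow_mul, ← pow_add]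
  congr 3
  have h1 : 1 ≤ p ^ i := Nat.one_le_pow _ _ (by omega)
  obtain ⟨c, hc⟩ := Nat.exists_eq_add_of_le h1
  rw [pow_succ, hc, Nat.add_sub_cancel_left, add_mul, one_mul]
  omega

/-- The polynomials which represent a splitting functional form a chain. -/
theorem IsSplitting.exists_chain {m : ℕ} (S : IsSplitting p (m + 1) r f χ) (hf : f ≠ 0)
    (hr : r ≤ 2) :
    ∃ a : ℕ → MvPolynomial σ k, f ^ (2 - r) ∣ a m ∧
      (∀ j, j < m → f ∣ a j + cartier p 1 (f ^ (p - 2) * (polyDelta p f * a (j + 1)))) ∧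
      (∀ j, 1 ≤ j → j ≤ m → f ∣ cartier p 1 (f ^ (p - 2) * a j)) ∧
      f ∣ cartier p 1 (f ^ (p - 2) * a 0) - 1 := by
  classical
  have := Fintype.ofFinite σ
  obtain ⟨h, H⟩ := S.exists_isReprBy
  have hp := (Fact.out : p.Prime)
  have h2 : ∀ i, 2 ≤ p ^ (i + 1) := fun i => hp.two_le.trans (Nat.le_self_pow (by omega) p)
  have hu : ∀ i, 1 ≤ i → i < m + 1 → f ^ p ^ i ∣ cartier p 1 (h i) :=
    fun i h1 hi => H.pow_dvd_cartier h1 hi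
  have hlast : f ^ (p ^ (m + 1) - r) ∣ h m := by
    have h3 : f ^ p ^ (m + 1) ∣ h m * f ^ r := by
      refine pow_dvd_of_dvd_cartier p (m + 1) fun e => ?_
      rw [mul_assoc, ← mk_span_eq_zero_iff, ← H.map_verschiebung_teichmuller, S.apply_pow_mul m _ rfl]
    have h4 : p ^ (m + 1) = p ^ (m + 1) - r + r := by have := h2 m; omega
    rw [h4, pow_add] at h3
    exact (mul_dvd_mul_iff_right (pow_ne_zero _ hf)).1 h3
  have hZ : ∀ j, j < m → (∀ i, j < i → i < m + 1 → f ^ (p ^ (i + 1) - 2) ∣ h i) →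
      f ^ p ^ (j + 1) ∣ f * h j + cartier p 1 (h (j + 1) * polyDelta p f) := by
    intro j hj hh
    refine pow_dvd_of_dvd_cartier p (j + 1) fun e => ?_
    have h3 := H.map_teichmuller_mul p (expansion_zero p f) (expansion_succ p f)
      (expansion_add_two p f) (j := j) (by omega) hu hh (polyLift p (monomial e 1))
    rw [red_polyLift] at h3
    rw [← mk_span_eq_zero_iff]
    refine h3.symm.trans ?_
    have h4 : teichHom p (polyLift p (monomial e (1 : k))) = teichSum p (monomial e 1) := rfl
    rw [h4, teichSum_monomial, ← map_mul]
    exact S.apply_mul j _ (by omega)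
  -- Descending induction on i = m - t. Divisibility of h_{i+1} makes u(h_{i+1} Δ(f)) divisible by
  -- f^(p^(i+1) - 1), so f h_i is too, and cancelling f leaves the exponent p^(i+1) - 2.
  have hdvd : ∀ t i, i + t = m → f ^ (p ^ (i + 1) - 2) ∣ h i := by
    intro t
    induction t using Nat.strong_induction_on with
    | _ t ih =>
      intro i hi
      rcases Nat.eq_zero_or_pos t with rfl | ht
      · obtain rfl : i = m := by omega
        exact (pow_dvd_pow f (by omega)).trans hlast
      · have h3 := hZ i (by omega) fun i' h3 h4 => ih (m - i') (by omega) i' (by omega)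
        obtain ⟨a, ha⟩ := ih (t - 1) (by omega) (i + 1) (by omega)
        rw [ha, mul_assoc, cartier_pow_sub_two_mul] at h3
        have h5 : f ^ (p ^ (i + 1) - 1) ∣ f * h i :=
          (dvd_add_left (Dvd.intro _ rfl)).1 ((pow_dvd_pow f (Nat.sub_le _ 1)).trans h3)
        have h6 : p ^ (i + 1) - 1 = (p ^ (i + 1) - 2) + 1 := by have := h2 i; omega
        rw [h6, pow_succ', mul_dvd_mul_iff_left hf] at h5
        exact h5
  have hdvd' : ∀ i, ∃ a, i ≤ m → h i = f ^ (p ^ (i + 1) - 2) * a := by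
    intro i
    by_cases hi : i ≤ m
    · obtain ⟨a, ha⟩ := hdvd (m - i) i (by omega)
      exact ⟨a, fun _ => ha⟩
    · exact ⟨0, fun h' => absurd h' hi⟩
  choose a ha using hdvd'
  have hdvd1 : ∀ i, i ≤ m → f ^ (p ^ (i + 1) - 2) ∣ h i := fun i hi => by
    rw [ha i hi]; exact Dvd.intro _ rfl
  have hlam : ∀ j, j ≤ m → cartier p 1 (h j) =
      f ^ (p ^ j - 1) * cartier p 1 (f ^ (p - 2) * a j) := by
    intro j hj
    rw [ha j hj, cartier_pow_sub_two_mul]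
  refine ⟨a, ?_, ?_, ?_, ?_⟩
  · have h3 : p ^ (m + 1) - r = (p ^ (m + 1) - 2) + (2 - r) := by have := h2 m; omega
    rw [h3, pow_add, ha m le_rfl] at hlast
    exact (mul_dvd_mul_iff_left (pow_ne_zero _ hf)).1 hlast
  · intro j hj
    have h3 := hZ j hj fun i _ hi => hdvd1 i (by omega)
    rw [ha j (by omega), ha (j + 1) (by omega), mul_assoc, cartier_pow_sub_two_mul] at h3
    have h6 : p ^ (j + 1) - 1 = (p ^ (j + 1) - 2) + 1 := by have := h2 j; omega
    have h7 : p ^ (j + 1) = (p ^ (j + 1) - 1) + 1 := by have := h2 j; omega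
    have h8 : f * (f ^ (p ^ (j + 1) - 2) * a j) = f ^ (p ^ (j + 1) - 1) * a j := by
      rw [h6, pow_succ]; ring
    rw [h8, ← mul_add, h7, pow_succ, Nat.add_sub_cancel,
      mul_dvd_mul_iff_left (pow_ne_zero _ hf), mul_comm (a (j + 1))] at h3
    exact h3
  · intro j h1 hj
    have h3 := hu j h1 (by omega)
    have h7 : p ^ j = (p ^ j - 1) + 1 := (Nat.sub_add_cancel (Nat.one_le_pow _ _ hp.pos)).symm
    rw [hlam j hj, h7, pow_succ, Nat.add_sub_cancel, mul_dvd_mul_iff_left (pow_ne_zero _ hf)] at h3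
    exact h3
  · have h3 := H.map_teichSum 0 (by omega) 1
    rw [teichSum_one, Function.iterate_zero_apply, S.apply_one, zero_add, mul_one, hlam 0 (by omega),
      pow_zero, Nat.sub_self, pow_zero, one_mul] at h3
    rw [← mk_span_eq_zero_iff, map_sub, ← h3, map_one, sub_self]

end Chains

/-! ### From chains of polynomials to splitting functionals. -/

section Construction

variable {σ k : Type*} [Finite σ] [Field k] {p : ℕ} [Fact p.Prime] [CharP k p] [PerfectRing k p]
  {r m : ℕ} {f : MvPolynomial σ k}

theorem teichmuller_add_verschiebung_shift {R : Type*} [CommRing R] (α : WittVector p R) :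
    α = WittVector.teichmuller p (α.coeff 0) + WittVector.verschiebung (α.shift 1) := by
  ext i
  rw [WittVector.coeff_add_of_disjoint]
  · cases i with
    | zero => rw [WittVector.teichmuller_coeff_zero, WittVector.verschiebung_coeff_zero, add_zero]
    | succ i => rw [WittVector.teichmuller_coeff_pos p _ _ i.succ_pos, zero_add,
        WittVector.verschiebung_coeff_succ, WittVector.shift_coeff, add_comm]
  · intro i
    cases i with
    | zero => exact Or.inr (WittVector.verschiebung_coeff_zero _)
    | succ i => exact Or.inl (WittVector.teichmuller_coeff_pos p _ _ i.succ_pos)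

theorem IsReprBy.map_verschiebung_last
    {χ : WittVector p (MvPolynomial σ k) →+ MvPolynomial σ k ⧸ Ideal.span {f}}
    {h : ℕ → MvPolynomial σ k} (H : IsReprBy p (m + 1) f χ h)
    (γ : WittVector p (MvPolynomial σ k)) :
    χ (WittVector.verschiebung^[m] γ) =
      Ideal.Quotient.mk _ (cartier p (m + 1) (h m * γ.coeff 0)) := by
  conv_lhs => rw [teichSum_add_teichTail p γ]
  rw [verschiebung_iterate_add, map_add,
    ← Function.iterate_succ_apply, H.map_verschiebung _ le_rfl, add_zero,
    H.map_teichSum _ (Nat.lt_succ_self m)]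

/-- Functionals represented by a chain vanish on the Witt vectors with components in
`(f), …, (f), (f ^ r)`. -/
theorem IsReprBy.eq_zero
    {χ : WittVector p (MvPolynomial σ k) →+ MvPolynomial σ k ⧸ Ideal.span {f}}
    {h : ℕ → MvPolynomial σ k} (H : IsReprBy p (m + 1) f χ h) (hr : r ≤ 2)
    (hu : ∀ i, 1 ≤ i → i < m + 1 → f ^ p ^ i ∣ cartier p 1 (h i))
    (hh : ∀ i, i ≤ m → f ^ (p ^ (i + 1) - 2) ∣ h i)
    (hlast : f ^ p ^ (m + 1) ∣ h m * f ^ r)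
    (hZ : ∀ j, j < m → f ^ p ^ (j + 1) ∣ f * h j + cartier p 1 (h (j + 1) * polyDelta p f))
    (α : WittVector p (MvPolynomial σ k)) (hα : ∀ i, i < m → f ∣ α.coeff i)
    (hαm : f ^ r ∣ α.coeff m) : χ α = 0 := by
  have hp := (Fact.out : p.Prime)
  have hm : ∀ s, r ≤ s → ∀ γ,
      χ (WittVector.verschiebung^[m] (WittVector.teichmuller p f ^ s * γ)) = 0 := by
    intro s hs γ
    rw [H.map_verschiebung_last, ← map_pow, WittVector.mul_coeff_zero,
      WittVector.teichmuller_coeff_zero, ← mul_assoc, mk_span_eq_zero_iff]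
    refine dvd_cartier_of_pow_dvd _ _ (Dvd.dvd.mul_right (hlast.trans ?_) _)
    exact mul_dvd_mul_left _ (pow_dvd_pow f hs)
  -- Descending induction on j. For γ = T(γ_0) + Vγ', the first part is the divisibility `hZ`, and
  -- [f] Vγ' = V([f]^p γ') contains [f]^2 since p ≥ 2. The statement for [f]^2 is carried along
  -- because it also holds at j = m, where [f] alone need not be killed when r = 2.
  have key : ∀ t j, j + t = m + 1 → ∀ γ,
      (j < m → χ (WittVector.verschiebung^[j] (WittVector.teichmuller p f * γ)) = 0) ∧
      χ (WittVector.verschiebung^[j] (WittVector.teichmuller p f ^ 2 * γ)) = 0 := by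
    intro t
    induction t with
    | zero => exact fun j hj γ => ⟨fun h => by omega, H.map_verschiebung _ (by omega) _⟩
    | succ t ih =>
      intro j hj γ
      have h1 : ∀ γ, j < m →
          χ (WittVector.verschiebung^[j] (WittVector.teichmuller p f * γ)) = 0 := by
        intro γ hjm
        have h2 : WittVector.teichmuller p f * WittVector.verschiebung (teichTail p γ) =
            WittVector.verschiebung (WittVector.teichmuller p f ^ 2 *
              (WittVector.teichmuller p f ^ (p - 2) * teichTail p γ)) := by
          rw [mul_comm, ← WittVector.verschiebung_mul_frobenius, frobenius_teichmuller,
            ← mul_assoc, ← pow_add, Nat.add_sub_of_le hp.two_le, mul_comm]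
        rw [teichSum_add_teichTail p γ, mul_add, verschiebung_iterate_add, map_add, h2,
          ← Function.iterate_succ_apply, (ih (j + 1) (by omega) _).2, add_zero, teichSum,
          H.map_teichmuller_mul p (expansion_zero p f) (expansion_succ p f)
            (expansion_add_two p f) (by omega) hu (fun i _ hi => hh i (by omega)),
          mk_span_eq_zero_iff]
        exact dvd_cartier_of_pow_dvd _ _ (Dvd.dvd.mul_right (hZ j hjm) _)
      refine ⟨h1 γ, ?_⟩
      rcases Nat.lt_or_ge j m with hjm | hjm
      · rw [pow_two, mul_assoc]
        exact h1 _ hjm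
      · obtain rfl : j = m := by omega
        exact hm 2 hr γ
  have hind : ∀ t j, j + t = m + 1 → ∀ α : WittVector p (MvPolynomial σ k),
      (∀ i, i + j < m → f ∣ α.coeff i) → (∀ i, i + j = m → f ^ r ∣ α.coeff i) →
      χ (WittVector.verschiebung^[j] α) = 0 := by
    intro t
    induction t with
    | zero => exact fun j hj α _ _ => H.map_verschiebung _ (by omega) _
    | succ t ih =>
      intro j hj α h1 h2
      rw [teichmuller_add_verschiebung_shift α, verschiebung_iterate_add, map_add,
        ← Function.iterate_succ_apply, ih (j + 1) (by omega), add_zero]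
      · rcases Nat.lt_or_ge j m with hjm | hjm
        · obtain ⟨c, hc⟩ := h1 0 (by omega)
          rw [hc, map_mul]
          exact (key (t + 1) j hj _).1 hjm
        · obtain rfl : j = m := by omega
          obtain ⟨c, hc⟩ := h2 0 (by omega)
          rw [hc, map_mul, map_pow]
          exact hm r le_rfl _
      · intro i hi
        rw [WittVector.shift_coeff]
        exact h1 _ (by omega)
      · intro i hi
        rw [WittVector.shift_coeff]
        exact h2 _ (by omega)
  exact hind (m + 1) 0 (by omega) α (fun i hi => hα i (by omega))
    (fun i hi => by obtain rfl : i = m := by omega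
                    exact hαm)

/-- A chain of polynomials yields a splitting functional. -/
theorem exists_splitting_of_chain (hr : r ≤ 2) (a : ℕ → MvPolynomial σ k)
    (ham : f ^ (2 - r) ∣ a m)
    (ha : ∀ j, j < m → f ∣ a j + cartier p 1 (f ^ (p - 2) * (polyDelta p f * a (j + 1))))
    (ha1 : ∀ j, 1 ≤ j → j ≤ m → cartier p 1 (f ^ (p - 2) * a j) = 0)
    (ha0 : cartier p 1 (f ^ (p - 2) * a 0) = 1) :
    ∃ φ : WittVector p (MvPolynomial σ k) →+ MvPolynomial σ k,
      (∀ w α, φ (WittVector.frobenius w * α) = w.coeff 0 * φ α) ∧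
      (∀ j, m + 1 ≤ j → ∀ α, φ (WittVector.verschiebung^[j] α) = 0) ∧ φ 1 = 1 ∧
      ∀ α : WittVector p (MvPolynomial σ k), (∀ i, i < m → f ∣ α.coeff i) →
        f ^ r ∣ α.coeff m → f ∣ φ α := by
  have hp := (Fact.out : p.Prime)
  have h2 : ∀ i, 2 ≤ p ^ (i + 1) := fun i => hp.two_le.trans (Nat.le_self_pow (by omega) p)
  -- The value 0 beyond m is harmless, since the functional has length m + 1, and it gives u(h_j) =
  -- 0 for every j ≥ 1, as additivity requires.
  let h : ℕ → MvPolynomial σ k := fun j => if j ≤ m then f ^ (p ^ (j + 1) - 2) * a j else 0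
  have hle : ∀ j, j ≤ m → h j = f ^ (p ^ (j + 1) - 2) * a j := fun j hj => if_pos hj
  have hu : ∀ j, 1 ≤ j → cartier p 1 (h j) = 0 := by
    intro j hj
    by_cases hjm : j ≤ m
    · rw [hle j hjm, cartier_pow_sub_two_mul, ha1 j hj hjm, mul_zero]
    · simp only [h, if_neg hjm, map_zero]
  let φ := wittFunctionalHom p hu (m + 1)
  refine ⟨φ, wittFunctionalHom_frobenius_mul p hu _,
    fun j hj α => wittFunctionalHom_verschiebung p hu hj α, ?_, ?_⟩
  · have := wittFunctionalHom_verschiebung_teichSum p hu (n := m + 1) (j := 0) (by omega) 1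
    rw [teichSum_one, Function.iterate_zero_apply, zero_add, mul_one, hle 0 (by omega),
      cartier_pow_sub_two_mul, ha0, pow_zero, Nat.sub_self, pow_zero, one_mul] at this
    exact this
  · intro α hα hαm
    have H : IsReprBy p (m + 1) f
        ((Ideal.Quotient.mk (Ideal.span {f})).toAddMonoidHom.comp φ) h :=
      { map_verschiebung := fun j hj α => by
          change Ideal.Quotient.mk _ (φ _) = 0
          rw [show φ _ = 0 from wittFunctionalHom_verschiebung p hu hj α, map_zero]
        map_p_mul := fun α => by
          change Ideal.Quotient.mk _ (φ _) = 0
          rw [show φ _ = 0 from wittFunctionalHom_p_mul p hu _ α, map_zero]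
        map_teichSum := fun j hj a => by
          change Ideal.Quotient.mk _ (φ _) = _
          rw [show φ _ = _ from wittFunctionalHom_verschiebung_teichSum p hu hj a] }
    rw [← mk_span_eq_zero_iff]
    refine H.eq_zero hr (fun i h1 _ => ?_) (fun i hi => ?_) ?_ (fun j hj => ?_) α hα hαm
    · rw [hu i h1]
      exact dvd_zero _
    · rw [hle i hi]
      exact Dvd.intro _ rfl
    · have h3 : p ^ (m + 1) = (p ^ (m + 1) - 2) + (2 - r) + r := by have := h2 m; omega
      rw [hle m le_rfl, h3, pow_add, pow_add, ← h3]
      exact mul_dvd_mul_right (mul_dvd_mul_left _ ham) _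
    · have h6 : p ^ (j + 1) - 1 = (p ^ (j + 1) - 2) + 1 := by have := h2 j; omega
      have h7 : p ^ (j + 1) = (p ^ (j + 1) - 1) + 1 := by have := h2 j; omega
      have h8 : f * (f ^ (p ^ (j + 1) - 2) * a j) = f ^ (p ^ (j + 1) - 1) * a j := by
        rw [h6, pow_succ]; ring
      rw [hle j (by omega), hle (j + 1) (by omega), h8, mul_assoc, cartier_pow_sub_two_mul,
        ← mul_add, h7, pow_succ, Nat.add_sub_cancel, mul_comm (a (j + 1))]
      exact mul_dvd_mul_left _ (ha j hj)

end Construction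

/-! ### Gradings -/

section Graded

variable {σ k : Type*} [Field k] {p : ℕ} [Fact p.Prime] [CharP k p] [PerfectRing k p]
  {w : σ → ℕ} {f : MvPolynomial σ k}

/-- Both L^p and φ(L) are homogeneous of degree p d over W(k), and p is a nonzero element of the
domain W(k), so dividing by it preserves this. -/
theorem polyDelta_isWeightedHomogeneous {d : ℕ} (hf : IsWeightedHomogeneous w f d) :
    IsWeightedHomogeneous w (polyDelta p f) (p * d) := by
  classical
  have hL : IsWeightedHomogeneous w (polyLift p f) d := by
    intro e he
    rw [coeff_polyLift] at he
    refine hf (fun h => he ?_)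
    rw [h, WittVector.teichmuller_zero]
  have hF : IsWeightedHomogeneous w (frobLift p (polyLift p f)) (p * d) := by
    rw [(polyLift p f).as_sum, map_sum]
    refine IsWeightedHomogeneous.sum _ _ _ fun e he => ?_
    have h1 : frobLift p (monomial e (coeff e (polyLift p f))) =
        monomial (p • e) (WittVector.frobenius (coeff e (polyLift p f))) := by
      simp only [frobLift, RingHom.comp_apply, AlgHom.toRingHom_eq_coe, RingHom.coe_coe,
        map_monomial, expand_monomial]
    rw [h1]
    apply isWeightedHomogeneous_monomial
    rw [map_nsmul, hL (mem_support_iff.1 he), smul_eq_mul]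
  have h1 := expansion_succ p f 0
  rw [zero_add, pow_one, pow_one, pow_zero, pow_one] at h1
  intro e he
  by_contra hne
  apply he
  have h2 : coeff e ((p : MvPolynomial σ (WittVector p k)) * expansion p f 1) = 0 := by
    have h3 : (p : MvPolynomial σ (WittVector p k)) * expansion p f 1 =
        polyLift p f ^ p - frobLift p (polyLift p f) := by rw [h1]; ring
    rw [h3, coeff_sub, (hL.pow p).coeff_eq_zero e (by simpa using hne), hF.coeff_eq_zero e hne,
      sub_zero]
  rw [← map_natCast (C : WittVector p k →+* MvPolynomial σ (WittVector p k)), coeff_C_mul,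
    mul_eq_zero] at h2
  rw [polyDelta, red, coeff_map, h2.resolve_left (WittVector.p_nonzero p k), map_zero]

theorem weightedHomogeneousComponent_mul {R : Type*} [CommRing R] {g a : MvPolynomial σ R}
    {s : ℕ} (hg : IsWeightedHomogeneous w g s) (m : ℕ) :
    weightedHomogeneousComponent w (s + m) (g * a) =
      g * weightedHomogeneousComponent w m a := by
  classical
  ext e
  rw [coeff_weightedHomogeneousComponent, coeff_mul, coeff_mul]
  split_ifs with he
  · refine Finset.sum_congr rfl fun x hx => ?_
    rw [coeff_weightedHomogeneousComponent]
    split_ifs with h2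
    · rfl
    · rw [mul_zero]
      by_cases h3 : coeff x.1 g = 0
      · rw [h3, zero_mul]
      · exfalso
        have h4 := hg h3
        rw [← Finset.HasAntidiagonal.mem_antidiagonal.1 hx, map_add] at he
        omega
  · refine (Finset.sum_eq_zero fun x hx => ?_).symm
    rw [coeff_weightedHomogeneousComponent]
    split_ifs with h2
    · by_cases h3 : coeff x.1 g = 0
      · rw [h3, zero_mul]
      · exfalso
        have h4 := hg h3
        rw [← Finset.HasAntidiagonal.mem_antidiagonal.1 hx, map_add] at he
        omega
    · rw [mul_zero]

variable [Fintype σ]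

theorem weight_cartierExp {q : ℕ} (e : σ →₀ ℕ) :
    Finsupp.weight w (cartierExp q 1 e) = q * Finsupp.weight w e + (q - 1) * ∑ i, w i := by
  rw [Finsupp.weight_apply, Finsupp.weight_apply, Finsupp.sum_fintype _ _ (by simp),
    Finsupp.sum_fintype _ _ (by simp)]
  simp only [smul_eq_mul, cartierExp_apply, pow_one, add_mul, Finset.sum_add_distrib,
    Finset.mul_sum, mul_assoc]

theorem weightedHomogeneousComponent_cartier (m : ℕ) (a : MvPolynomial σ k) :
    weightedHomogeneousComponent w m (cartier p 1 a) =
      cartier p 1 (weightedHomogeneousComponent w (p * m + (p - 1) * ∑ i, w i) a) := by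
  classical
  ext e
  rw [coeff_cartier, coeff_weightedHomogeneousComponent, coeff_weightedHomogeneousComponent,
    coeff_cartier, weight_cartierExp]
  have h : p * Finsupp.weight w e + (p - 1) * ∑ i, w i = p * m + (p - 1) * ∑ i, w i ↔
      Finsupp.weight w e = m := by
    rw [Nat.add_right_cancel_iff, Nat.mul_right_inj (Fact.out : p.Prime).ne_zero]
  simp only [h]
  split_ifs
  · rfl
  · rw [map_zero]

variable (p f) in
/-- The operator `a ↦ -u(f ^ (p - 2) Δ(f) a)`, where `u` is the Cartier operator. -/
def chainMap : MvPolynomial σ k →+ MvPolynomial σ k where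
  toFun a := -cartier p 1 (f ^ (p - 2) * (polyDelta p f * a))
  map_zero' := by simp
  map_add' a b := by rw [mul_add, mul_add, map_add, neg_add]

variable (p f) in
/-- The functional `a ↦ u(f ^ (p - 2) a)`, where `u` is the Cartier operator. -/
def chainEnd : MvPolynomial σ k →+ MvPolynomial σ k where
  toFun a := cartier p 1 (f ^ (p - 2) * a)
  map_zero' := by simp
  map_add' a b := by rw [mul_add, map_add]

/-- The Calabi–Yau condition enters here: u maps degree p m + (p - 1) ∑ w_i to degree m, and with d
= ∑ w_i multiplication by f^(p-2) Δ(f) shifts degree d to (p - 2)d + p d + d = p d + (p - 1)d. -/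
theorem weightedHomogeneousComponent_chainMap
    (hf : IsWeightedHomogeneous w f (∑ i, w i)) (a : MvPolynomial σ k) :
    weightedHomogeneousComponent w (∑ i, w i) (chainMap p f a) =
      chainMap p f (weightedHomogeneousComponent w (∑ i, w i) a) := by
  set d := ∑ i, w i with hd
  have hp := (Fact.out : p.Prime).two_le
  have h1 : p * d + (p - 1) * d = (p - 2) * d + (p * d + d) := by
    obtain ⟨c, rfl⟩ := Nat.exists_eq_add_of_le hp
    simp only [Nat.add_sub_cancel_left, show 2 + c - 1 = c + 1 by omega]
    ring
  change weightedHomogeneousComponent w d (-cartier p 1 _) = -cartier p 1 _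
  rw [map_neg, weightedHomogeneousComponent_cartier, ← hd, h1,
    weightedHomogeneousComponent_mul (by simpa using hf.pow (p - 2)),
    weightedHomogeneousComponent_mul (polyDelta_isWeightedHomogeneous hf)]

/-- The same count without Δ(f): (p - 2)d + d = (p - 1)d is the degree that u maps to 0. -/
theorem weightedHomogeneousComponent_chainEnd
    (hf : IsWeightedHomogeneous w f (∑ i, w i)) (a : MvPolynomial σ k) :
    weightedHomogeneousComponent w 0 (chainEnd p f a) =
      chainEnd p f (weightedHomogeneousComponent w (∑ i, w i) a) := by
  set d := ∑ i, w i with hd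
  have hp := (Fact.out : p.Prime).two_le
  have h1 : p * 0 + (p - 1) * d = (p - 2) * d + d := by
    obtain ⟨c, rfl⟩ := Nat.exists_eq_add_of_le hp
    simp only [Nat.add_sub_cancel_left, show 2 + c - 1 = c + 1 by omega]
    ring
  change weightedHomogeneousComponent w 0 (cartier p 1 _) = cartier p 1 _
  rw [weightedHomogeneousComponent_cartier, ← hd, h1,
    weightedHomogeneousComponent_mul (by simpa using hf.pow (p - 2))]

end Graded

/-! ### Chains in a vector space with a `p⁻¹`-linear operator -/

section LinearAlgebra

variable {K W : Type*} [Field K] [AddCommGroup W] [Module K W] {p : ℕ}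

/-- Sequences `a_0, …, a_m` with `a_j ∈ θ(a_{j+1}) + K v`, `l(a_j) = 0` for `j ≥ 1`, `l(a_0) = 1`,
and whose last term satisfies `P`. -/
def IsChain (θ : W →+ W) (l : W →+ K) (v : W) (P : W → Prop) (m : ℕ) (a : ℕ → W) : Prop :=
  (∀ j, j < m → ∃ b : K, a j = θ (a (j + 1)) + b • v) ∧
    (∀ j, 1 ≤ j → j ≤ m → l (a j) = 0) ∧ l (a 0) = 1 ∧ P (a m)

variable {θ : W →+ W} {l : W →+ K} {v : W}

theorem IsChain.of_le {a : ℕ → W} {P : W → Prop} {m n : ℕ} (h : IsChain θ l v P m a)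
    (hmn : n ≤ m) : IsChain θ l v (fun _ => True) n a :=
  ⟨fun j hj => h.1 j (by omega), fun j h1 hj => h.2.1 j h1 (by omega), h.2.2.1, trivial⟩

/-- Padding by zeros is allowed precisely because the last term b v equals θ(0) + b v. -/
theorem IsChain.exists_of_le {a : ℕ → W} {m n : ℕ}
    (h : IsChain θ l v (fun x => ∃ b : K, x = b • v) m a) (hmn : m ≤ n) :
    ∃ a', IsChain θ l v (fun x => ∃ b : K, x = b • v) n a' := by
  refine ⟨fun j => if j ≤ m then a j else 0, fun j hj => ?_, fun j h1 hj => ?_, ?_, ?_⟩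
  · dsimp only
    rcases lt_trichotomy j m with hjm | rfl | hjm
    · rw [if_pos hjm.le, if_pos (Nat.succ_le_of_lt hjm)]
      exact h.1 j hjm
    · obtain ⟨b, hb⟩ := h.2.2.2
      exact ⟨b, by rw [if_pos le_rfl, if_neg (by omega), map_zero, zero_add, hb]⟩
    · exact ⟨0, by rw [if_neg (by omega), if_neg (by omega), map_zero, zero_smul, add_zero]⟩
  · dsimp only
    split_ifs with hjm
    · exact h.2.1 j h1 hjm
    · exact map_zero l
  · dsimp only
    rw [if_pos (Nat.zero_le m)]
    exact h.2.2.1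
  · dsimp only
    split_ifs with hjm
    · obtain rfl : n = m := by omega
      exact h.2.2.2
    · exact ⟨0, by rw [zero_smul]⟩

theorem map_iterate_smul (hθ : ∀ (c : K) (x : W), θ (c ^ p • x) = c • θ x)
    (hl : ∀ (c : K) (x : W), l (c ^ p • x) = c * l x) (i : ℕ) (c : K) (x : W) :
    l (θ^[i] (c ^ p ^ (i + 1) • x)) = c * l (θ^[i] x) := by
  induction i generalizing x with
  | zero => simpa using hl c x
  | succ i ih => rw [Function.iterate_succ_apply, Function.iterate_succ_apply, pow_succ p (i + 1),
      pow_mul, hθ, ih]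

/-- If there are chains of all lengths, then there is one whose last term is in `K v`. -/
theorem exists_isChain_smul [Fact p.Prime] [CharP K p] [PerfectRing K p] [FiniteDimensional K W]
    (hθ : ∀ (c : K) (x : W), θ (c ^ p • x) = c • θ x)
    (hl : ∀ (c : K) (x : W), l (c ^ p • x) = c * l x)
    (H : ∀ m, ∃ a, IsChain θ l v (fun _ => True) m a) :
    ∃ m a, IsChain θ l v (fun x => ∃ b : K, x = b • v) m a := by
  classical
  have hroot : ∀ (i : ℕ) (c : K), ∃ c', c' ^ p ^ i = c := fun i c => ⟨root p i c, pow_root p i c⟩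
  by_cases hv : ∃ i, l (θ^[i] v) ≠ 0
  · obtain ⟨i, hi, hlt⟩ : ∃ i, l (θ^[i] v) ≠ 0 ∧ ∀ j, j < i → l (θ^[j] v) = 0 :=
      ⟨Nat.find hv, Nat.find_spec hv, fun j hj => not_not.1 (Nat.find_min hv hj)⟩
    -- With i minimal, the iterates of θ on b v form a chain: minimality gives the vanishing for j ≥
    -- 1. Since l ∘ θ^i is p^(-(i+1))-linear, the power p^(i+1) in b normalizes the value at j = 0
    -- to 1.
    set b := (l (θ^[i] v))⁻¹ ^ p ^ (i + 1) with hb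
    refine ⟨i, fun j => θ^[i - j] (b • v), fun j hj => ⟨0, ?_⟩, fun j h1 hj => ?_, ?_, b, ?_⟩
    · dsimp only
      rw [zero_smul, add_zero, show i - j = i - (j + 1) + 1 by omega,
        Function.iterate_succ_apply']
    · obtain ⟨c, hc⟩ := hroot (i - j + 1) b
      rw [← hc, map_iterate_smul hθ hl, hlt _ (by omega), mul_zero]
    · dsimp only
      rw [Nat.sub_zero, hb, map_iterate_smul hθ hl, inv_mul_cancel₀ hi]
    · dsimp only
      rw [Nat.sub_self, Function.iterate_zero_apply]
  · exfalso
    push Not at hv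
    have hbv : ∀ i (b : K), l (θ^[i] (b • v)) = 0 := by
      intro i b
      obtain ⟨c, hc⟩ := hroot (i + 1) b
      rw [← hc, map_iterate_smul hθ hl, hv, mul_zero]
    -- These are subspaces although l ∘ θ^i is only p^(-(i+1))-linear, since every scalar is a
    -- p^(i+1)-th power. They decrease, so U_n = U_{n+1} for some n.
    let U : ℕ → Submodule K W := fun n =>
      { carrier := {x | ∀ i, i < n → l (θ^[i] x) = 0}
        zero_mem' := fun i _ => by rw [iterate_map_zero, map_zero]
        add_mem' := fun {x y} hx hy i hi => by
          rw [iterate_map_add, map_add, hx i hi, hy i hi, add_zero]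
        smul_mem' := fun b x hx i hi => by
          obtain ⟨c, hc⟩ := hroot (i + 1) b
          rw [← hc, map_iterate_smul hθ hl, hx i hi, mul_zero] }
    have hU : Antitone U := fun n n' hn x hx i hi => hx i (lt_of_lt_of_le hi hn)
    obtain ⟨n, hn⟩ := IsArtinian.monotone_stabilizes (⟨U, hU⟩ : ℕ →o (Submodule K W)ᵒᵈ)
    obtain ⟨a, h1, h2, h3, -⟩ := H n
    -- The multiples of v in the chain relation are invisible to every l ∘ θ^i, so l(θ^t(a_n)) can
    -- be read off as l(a_{n-t}). Then a_n lies in U_n but l(θ^n(a_n)) = 1, so it is not in U_{n+1}.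
    have hval : ∀ t j, j + t = n → l (θ^[t] (a n)) = l (a j) := by
      have : ∀ t j, j + t ≤ n → ∀ i, l (θ^[i] (θ^[t] (a (j + t)))) = l (θ^[i] (a j)) := by
        intro t
        induction t with
        | zero => intro j _ i; rfl
        | succ t ih =>
          intro j hj i
          obtain ⟨b, hb⟩ := h1 j (by omega)
          have := ih (j + 1) (by omega) (i + 1)
          rw [hb, iterate_map_add, map_add, hbv, add_zero, ← Function.iterate_succ_apply, ← this,
            show j + 1 + t = j + (t + 1) by ring, ← Function.iterate_add_apply,
            ← Function.iterate_add_apply]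
          congr 2
          omega
      intro t j hj
      have := this t j (by omega) 0
      rwa [hj] at this
    have hmem : a n ∈ U n := fun i hi => by
      rw [hval i (n - i) (by omega), h2 _ (by omega) (by omega)]
    have hmem' : a n ∈ U (n + 1) := by
      have := hn (n + 1) (Nat.le_succ n)
      exact (congrArg (fun S : Submodule K W => a n ∈ S) this).mp hmem
    have := hmem' n (Nat.lt_succ_self n)
    rw [hval n 0 (by omega), h3] at this
    exact one_ne_zero this

end LinearAlgebra

/-! ### Chains of homogeneous polynomials of degree equal to the sum of the weights. -/

section GradedChains

theorem isWeightedHomogeneous_of_component_eq {σ R : Type*} [CommRing R] {w : σ → ℕ}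
    {x : MvPolynomial σ R} {d : ℕ} (h : weightedHomogeneousComponent w d x = x) : IsWeightedHomogeneous w x d :=
  h ▸ weightedHomogeneousComponent_isWeightedHomogeneous d x

variable {σ k : Type*} [Fintype σ] [Field k] {p : ℕ} [Fact p.Prime] [CharP k p] [PerfectRing k p]
  {w : σ → ℕ} {f : MvPolynomial σ k}

variable (p) in
/-- The restriction of `chainMap` to the homogeneous polynomials of degree `∑ w i`. -/
def gradedChainMap (hf : IsWeightedHomogeneous w f (∑ i, w i)) :
    weightedHomogeneousSubmodule k w (∑ i, w i) →+
      weightedHomogeneousSubmodule k w (∑ i, w i) where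
  toFun x := ⟨chainMap p f x, by
    rw [mem_weightedHomogeneousSubmodule]
    apply isWeightedHomogeneous_of_component_eq
    rw [weightedHomogeneousComponent_chainMap hf, x.2.weightedHomogeneousComponent_same]⟩
  map_zero' := Subtype.ext (map_zero (chainMap p f))
  map_add' x y := Subtype.ext (map_add (chainMap p f) x.1 y.1)

variable (p w f) in
/-- The functional on the homogeneous polynomials of degree `∑ w i` given by `chainEnd`. -/
def gradedChainEnd : weightedHomogeneousSubmodule k w (∑ i, w i) →+ k where
  toFun x := coeff 0 (chainEnd p f x)
  map_zero' := by simp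
  map_add' x y := by simp

theorem chainEnd_eq_C (hw : ∀ i, w i ≠ 0) (hf : IsWeightedHomogeneous w f (∑ i, w i))
    (x : weightedHomogeneousSubmodule k w (∑ i, w i)) :
    chainEnd p f x = C (gradedChainEnd p w f x) := by
  rw [← x.2.weightedHomogeneousComponent_same, ← weightedHomogeneousComponent_chainEnd hf,
    weightedHomogeneousComponent_zero _ hw]
  congr 1

theorem gradedChainMap_smul (hf : IsWeightedHomogeneous w f (∑ i, w i)) (c : k)
    (x : weightedHomogeneousSubmodule k w (∑ i, w i)) :
    gradedChainMap p hf (c ^ p • x) = c • gradedChainMap p hf x := by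
  apply Subtype.ext
  change -cartier p 1 (f ^ (p - 2) * (polyDelta p f * (c ^ p • x.1))) =
    c • -cartier p 1 (f ^ (p - 2) * (polyDelta p f * x.1))
  rw [smul_neg, smul_eq_C_mul, smul_eq_C_mul, map_pow, ← cartier_one_pow_mul]
  congr 2
  ring

theorem gradedChainEnd_smul (c : k) (x : weightedHomogeneousSubmodule k w (∑ i, w i)) :
    gradedChainEnd p w f (c ^ p • x) = c * gradedChainEnd p w f x := by
  change coeff 0 (cartier p 1 (f ^ (p - 2) * (c ^ p • x.1))) =
    c * coeff 0 (cartier p 1 (f ^ (p - 2) * x.1))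
  rw [smul_eq_C_mul, map_pow, mul_left_comm, cartier_one_pow_mul, coeff_C_mul]

/-- Turns the congruences modulo f for the values in k into equalities: f has positive degree, hence
no constant term. -/
theorem coeff_zero_of_dvd (hf : IsWeightedHomogeneous w f (∑ i, w i)) (hd : 0 < ∑ i, w i)
    {x : MvPolynomial σ k} (hx : f ∣ x) : coeff 0 x = 0 := by
  obtain ⟨c, rfl⟩ := hx
  rw [← constantCoeff_eq, map_mul, constantCoeff_eq, hf.coeff_eq_zero 0 (by rw [map_zero]; exact hd.ne), zero_mul]

/-- Turns a congruence modulo f in degree d = deg f into an equality up to the line k f, since the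
cofactor has degree 0 and all weights are positive. -/
theorem component_of_dvd (hw : ∀ i, w i ≠ 0) (hf : IsWeightedHomogeneous w f (∑ i, w i))
    {x : MvPolynomial σ k} (hx : f ∣ x) :
    ∃ b : k, weightedHomogeneousComponent w (∑ i, w i) x = b • f := by
  obtain ⟨c, rfl⟩ := hx
  refine ⟨coeff 0 c, ?_⟩
  have := weightedHomogeneousComponent_mul (a := c) hf 0
  rw [add_zero] at this
  rw [this, weightedHomogeneousComponent_zero _ hw, smul_eq_C_mul, mul_comm]

/-- Splitting functionals yield chains of homogeneous polynomials. -/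
theorem IsSplitting.exists_isChain (hw : ∀ i, w i ≠ 0)
    (hf : IsWeightedHomogeneous w f (∑ i, w i)) (hd : 0 < ∑ i, w i) (hf0 : f ≠ 0) {m r : ℕ}
    (hr : r ≤ 2)
    {χ : WittVector p (MvPolynomial σ k) →+ MvPolynomial σ k ⧸ Ideal.span {f}}
    (S : IsSplitting p (m + 1) r f χ) :
    ∃ a, IsChain (gradedChainMap p hf) (gradedChainEnd p w f) ⟨f, hf⟩
      (fun x => r = 1 → ∃ b : k, x = b • (⟨f, hf⟩ :
        weightedHomogeneousSubmodule k w (∑ i, w i))) m a := by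
  obtain ⟨a, ham, ha, ha1, ha0⟩ := S.exists_chain hf0 hr
  have hval : ∀ x : MvPolynomial σ k, gradedChainEnd p w f ⟨weightedHomogeneousComponent w _ x,
      weightedHomogeneousComponent_isWeightedHomogeneous _ x⟩ = coeff 0 (chainEnd p f x) := by
    intro x
    change coeff 0 (chainEnd p f (weightedHomogeneousComponent w _ x)) = _
    rw [← weightedHomogeneousComponent_chainEnd hf, weightedHomogeneousComponent_zero _ hw,
      coeff_zero_C]
  refine ⟨fun j => ⟨weightedHomogeneousComponent w _ (a j),
    weightedHomogeneousComponent_isWeightedHomogeneous _ (a j)⟩, fun j hj => ?_,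
    fun j h1 hj => ?_, ?_, fun h1 => ?_⟩
  · obtain ⟨b, hb⟩ := component_of_dvd hw hf (ha j hj)
    refine ⟨b, Subtype.ext ?_⟩
    change weightedHomogeneousComponent w _ (a j) =
      chainMap p f (weightedHomogeneousComponent w _ (a (j + 1))) + b • f
    rw [← weightedHomogeneousComponent_chainMap hf, ← hb, ← map_add]
    congr 1
    change a j = -cartier p 1 _ + _
    ring
  · rw [hval]
    exact coeff_zero_of_dvd hf hd (ha1 j h1 hj)
  · rw [hval]
    have := coeff_zero_of_dvd hf hd ha0
    rw [coeff_sub, coeff_zero_one, sub_eq_zero] at this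
    exact this
  · rw [h1] at ham
    obtain ⟨b, hb⟩ := component_of_dvd hw hf (by simpa using ham)
    exact ⟨b, Subtype.ext hb⟩

/-- Chains of homogeneous polynomials yield splitting functionals. -/
theorem IsChain.exists_splitting (hw : ∀ i, w i ≠ 0)
    (hf : IsWeightedHomogeneous w f (∑ i, w i)) {m r : ℕ} (hr1 : 1 ≤ r) (hr : r ≤ 2)
    {a : ℕ → weightedHomogeneousSubmodule k w (∑ i, w i)}
    (S : IsChain (gradedChainMap p hf) (gradedChainEnd p w f) ⟨f, hf⟩
      (fun x => r = 1 → ∃ b : k, x = b • (⟨f, hf⟩ :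
        weightedHomogeneousSubmodule k w (∑ i, w i))) m a) :
    ∃ φ : WittVector p (MvPolynomial σ k) →+ MvPolynomial σ k,
      (∀ w α, φ (WittVector.frobenius w * α) = w.coeff 0 * φ α) ∧
      (∀ j, m + 1 ≤ j → ∀ α, φ (WittVector.verschiebung^[j] α) = 0) ∧ φ 1 = 1 ∧
      ∀ α : WittVector p (MvPolynomial σ k), (∀ i, i < m → f ∣ α.coeff i) →
        f ^ r ∣ α.coeff m → f ∣ φ α := by
  obtain ⟨h1, h2, h3, h4⟩ := S
  refine exists_splitting_of_chain hr (fun j => (a j : MvPolynomial σ k)) ?_ ?_ ?_ ?_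
  · by_cases hr' : r = 1
    · obtain ⟨b, hb⟩ := h4 hr'
      rw [hb, hr', show 2 - 1 = 1 from rfl, pow_one]
      change f ∣ b • f
      rw [smul_eq_C_mul]
      exact Dvd.intro_left _ rfl
    · obtain rfl : r = 2 := by omega
      rw [Nat.sub_self, pow_zero]
      exact one_dvd _
  · intro j hj
    obtain ⟨b, hb⟩ := h1 j hj
    have : (a j : MvPolynomial σ k) =
        -cartier p 1 (f ^ (p - 2) * (polyDelta p f * (a (j + 1) : MvPolynomial σ k))) + b • f :=
      congrArg Subtype.val hb
    rw [this, neg_add_cancel_comm, smul_eq_C_mul]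
    exact Dvd.intro_left _ rfl
  · intro j hj1 hj
    have := chainEnd_eq_C (p := p) hw hf (a j)
    rw [h2 j hj1 hj, map_zero] at this
    exact this
  · have := chainEnd_eq_C (p := p) hw hf (a 0)
    rw [h3, map_one] at this
    exact this

end GradedChains

/-! ### Quasi-`F`-splittings of `k[x] / (f)` -/

section Quotient

theorem wittF_truncate_map {p : ℕ} [Fact p.Prime] {R S : Type*} [CommRing R] [CharP R p] [CommRing S]
    (g : R →+* S) (n : ℕ) (x : WittVector p R) :
    wittF p (WittVector.truncate n (WittVector.map g x)) =
      WittVector.truncate n (WittVector.map g (WittVector.frobenius x)) := by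
  ext i
  simp [wittF, WittVector.coeff_frobenius_charP, WittVector.map_coeff]

theorem truncate_map_verschiebung {p : ℕ} [Fact p.Prime] {R S : Type*} [CommRing R] [CommRing S]
    (g : R →+* S) {n j : ℕ} (hj : n ≤ j) (x : WittVector p R) :
    WittVector.truncate n (WittVector.map g (WittVector.verschiebung^[j] x)) = 0 := by
  ext i
  rw [WittVector.coeff_truncate, WittVector.map_coeff,
    WittVector.iterate_verschiebung_coeff_eq_zero _ (i.2.trans_le hj), map_zero,
    TruncatedWittVector.coeff_zero]

theorem map_verschiebung_iterate {p : ℕ} [Fact p.Prime] {R S : Type*} [CommRing R] [CommRing S]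
    (g : R →+* S) (j : ℕ) (x : WittVector p R) :
    WittVector.map g (WittVector.verschiebung^[j] x) =
      WittVector.verschiebung^[j] (WittVector.map g x) := by
  induction j generalizing x with
  | zero => rfl
  | succ j ih => rw [Function.iterate_succ_apply, ih, WittVector.map_verschiebung,
      Function.iterate_succ_apply]

variable {σ k : Type*} [Finite σ] [Field k] {p : ℕ} [Fact p.Prime] [CharP k p] [PerfectRing k p]
  {f : MvPolynomial σ k}

/-- The splitting is precomposed with W(A) → W_n(A/(f)). All V^j[f b] die there, including at the
last level, whence r = 1. -/
theorem IsNQuasiFSplit.exists_isSplitting {n : ℕ}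
    (H : IsNQuasiFSplit p n (MvPolynomial σ k ⧸ Ideal.span {f})) :
    0 < n ∧ ∃ χ, IsSplitting p n 1 f χ := by
  obtain ⟨hn, φ, h1, h2⟩ := H
  set g := Ideal.Quotient.mk (Ideal.span {f}) with hg
  have hzero : ∀ j b, WittVector.map g
      (WittVector.verschiebung^[j] (WittVector.teichmuller p (f * b))) = 0 := by
    intro j b
    rw [map_verschiebung_iterate, WittVector.map_teichmuller,
      mk_span_eq_zero_iff.2 (Dvd.intro _ rfl), WittVector.teichmuller_zero, iterate_map_zero]
  refine ⟨hn, (φ.comp (WittVector.truncate n).toAddMonoidHom).comp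
    (WittVector.map g).toAddMonoidHom, ⟨fun w α => ?_, fun j hj α => ?_, ?_, fun j b _ => ?_,
      fun j b _ => ?_⟩⟩
  · change φ (WittVector.truncate n (WittVector.map g _)) =
      _ * φ (WittVector.truncate n (WittVector.map g _))
    rw [map_mul, map_mul, ← wittF_truncate_map, h1]
    rfl
  · change φ (WittVector.truncate n (WittVector.map g _)) = 0
    rw [truncate_map_verschiebung g hj, map_zero]
  · change φ (WittVector.truncate n (WittVector.map g _)) = 1
    have h3 := wittF_truncate_map g n (1 : WittVector p (MvPolynomial σ k))
    have h4 := h2 (WittVector.truncate n (WittVector.map g 1))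
    rw [h3, map_one WittVector.frobenius] at h4
    rw [h4, WittVector.coeff_truncate, WittVector.map_coeff, WittVector.one_coeff_zero, map_one]
  · change φ (WittVector.truncate n (WittVector.map g _)) = 0
    rw [hzero, map_zero, map_zero]
  · change φ (WittVector.truncate n (WittVector.map g _)) = 0
    rw [pow_one, hzero, map_zero, map_zero]

/-- The kernel of the surjection W(A) → W_n(A/(f)) consists of the Witt vectors whose first m + 1
components lie in (f), so the last hypothesis says that φ modulo f descends. -/
theorem isNQuasiFSplit_of_splitting {m : ℕ}
    {φ : WittVector p (MvPolynomial σ k) →+ MvPolynomial σ k}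
    (h1 : ∀ w α, φ (WittVector.frobenius w * α) = w.coeff 0 * φ α) (h3 : φ 1 = 1)
    (h4 : ∀ α : WittVector p (MvPolynomial σ k), (∀ i, i < m → f ∣ α.coeff i) →
        f ^ 1 ∣ α.coeff m → f ∣ φ α) :
    IsNQuasiFSplit p (m + 1) (MvPolynomial σ k ⧸ Ideal.span {f}) := by
  set g := Ideal.Quotient.mk (Ideal.span {f}) with hg
  let τ : WittVector p (MvPolynomial σ k) →+*
      TruncatedWittVector p (m + 1) (MvPolynomial σ k ⧸ Ideal.span {f}) :=
    (WittVector.truncate (m + 1)).comp (WittVector.map g)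
  have hτ : Function.Surjective τ := (WittVector.truncate_surjective p _ _).comp
    (WittVector.map_surjective g Ideal.Quotient.mk_surjective)
  have hτc : ∀ x (i : Fin (m + 1)), (τ x).coeff i = g (x.coeff i) := fun x i => by
    rw [RingHom.comp_apply, WittVector.coeff_truncate, WittVector.map_coeff]
  have hker : ∀ x, τ x = 0 → g (φ x) = 0 := by
    intro x hx
    have hc : ∀ i, i < m + 1 → f ∣ x.coeff i := by
      intro i hi
      rw [← mk_span_eq_zero_iff]
      have := hτc x ⟨i, hi⟩
      rw [hx, TruncatedWittVector.coeff_zero] at this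
      exact this.symm
    rw [hg, mk_span_eq_zero_iff]
    exact h4 x (fun i hi => hc i (by omega)) (by simpa using hc m (by omega))
  have hwd : ∀ x y, τ x = τ y → g (φ x) = g (φ y) := by
    intro x y hxy
    rw [← sub_eq_zero, ← map_sub, ← map_sub]
    exact hker _ (by rw [map_sub, hxy, sub_self])
  choose s hs using hτ
  let ψ : TruncatedWittVector p (m + 1) (MvPolynomial σ k ⧸ Ideal.span {f}) →+
      MvPolynomial σ k ⧸ Ideal.span {f} :=
    { toFun := fun x => g (φ (s x))
      map_zero' := hker _ (hs 0)
      map_add' := fun x y => by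
        rw [← map_add, ← map_add]
        exact hwd _ _ (by rw [hs, map_add, hs, hs]) }
  have hψ : ∀ x, ψ (τ x) = g (φ x) := fun x => hwd _ _ (hs _)
  have hF : ∀ x, wittF p (τ x) = τ (WittVector.frobenius x) := fun x => wittF_truncate_map g _ x
  refine ⟨Nat.succ_pos m, ψ, fun w a => ?_, fun a => ?_⟩
  · rw [← hs w, ← hs a, hF, ← map_mul, hψ, hψ, h1, map_mul, hτc]
  · have h5 := h1 (s a) 1
    rw [h3, mul_one, mul_one] at h5
    rw [← hs a, hF, hψ, h5, hτc]

end Quotient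

/-! ### Orders along primes -/

section Order

variable {A : Type*} [CommRing A] [IsDomain A] [UniqueFactorizationMonoid A]

theorem multiplicity_mul_of_ne_zero {π a b : A} (hπ : Prime π) (ha : a ≠ 0) (hb : b ≠ 0) :
    multiplicity π (a * b) = multiplicity π a + multiplicity π b :=
  multiplicity_mul hπ (FiniteMultiplicity.of_not_isUnit hπ.not_isUnit (mul_ne_zero ha hb))

theorem multiplicity_pow_of_ne_zero {π a : A} (hπ : Prime π) (ha : a ≠ 0) (n : ℕ) :
    multiplicity π (a ^ n) = n * multiplicity π a :=
  FiniteMultiplicity.multiplicity_pow hπ (FiniteMultiplicity.of_not_isUnit hπ.not_isUnit ha)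

theorem ordAt_eq {π a b : A} (hπ : Prime π) (ha : a ≠ 0) (hb : b ≠ 0) {x : FractionRing A}
    (hx : x * algebraMap A (FractionRing A) b = algebraMap A (FractionRing A) a) :
    ordAt π x = multiplicity π a - multiplicity π b := by
  have hinj := IsFractionRing.injective A (FractionRing A)
  have hx0 : x ≠ 0 := by
    rintro rfl
    rw [zero_mul] at hx
    exact ha (hinj (by rw [← hx, map_zero]))
  have hnum : IsFractionRing.num A x ≠ 0 := fun h => hx0 ((IsFractionRing.num_eq_zero x).1 h)
  have hden : (IsFractionRing.den A x : A) ≠ 0 := nonZeroDivisors.coe_ne_zero _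
  have h : IsFractionRing.num A x * b = a * IsFractionRing.den A x := by
    apply hinj
    have h1 : algebraMap A (FractionRing A) (IsFractionRing.den A x : A) ≠ 0 := by
      rw [Ne, ← map_zero (algebraMap A (FractionRing A)), hinj.eq_iff]
      exact hden
    have h2 := IsFractionRing.mk'_num_den' A x
    rw [div_eq_iff h1] at h2
    rw [map_mul, map_mul, h2, ← hx]
    ring
  have h3 := congrArg (multiplicity π) h
  rw [multiplicity_mul_of_ne_zero hπ hnum hb, multiplicity_mul_of_ne_zero hπ ha hden] at h3
  rw [ordAt]
  omega

theorem ordAt_algebraMap {π a : A} (hπ : Prime π) (ha : a ≠ 0) :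
    ordAt π (algebraMap A (FractionRing A) a) = multiplicity π a := by
  rw [ordAt_eq (b := 1) hπ ha one_ne_zero (by rw [map_one, mul_one]),
    multiplicity_eq_zero.2 fun h => hπ.not_isUnit (isUnit_of_dvd_one h)]
  simp

theorem exists_mul_algebraMap_eq {x : FractionRing A} (hx : x ≠ 0) :
    ∃ a b : A, a ≠ 0 ∧ b ≠ 0 ∧
      x * algebraMap A (FractionRing A) b = algebraMap A (FractionRing A) a := by
  obtain ⟨a, b, hb, rfl⟩ := IsFractionRing.div_surjective A x
  have hb0 : algebraMap A (FractionRing A) b ≠ 0 := by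
    rw [Ne, ← map_zero (algebraMap A (FractionRing A)),
      (IsFractionRing.injective A (FractionRing A)).eq_iff]
    exact nonZeroDivisors.ne_zero hb
  refine ⟨a, b, ?_, nonZeroDivisors.ne_zero hb, div_mul_cancel₀ _ hb0⟩
  rintro rfl
  exact hx (by rw [map_zero, zero_div])

theorem ordAt_algebraMap_mul {π c : A} (hπ : Prime π) (hc : c ≠ 0) {x : FractionRing A}
    (hx : x ≠ 0) :
    ordAt π (algebraMap A (FractionRing A) c * x) = multiplicity π c + ordAt π x := by
  obtain ⟨a, b, ha, hb, h⟩ := exists_mul_algebraMap_eq hx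
  rw [ordAt_eq hπ (mul_ne_zero hc ha) hb (by rw [mul_assoc, h, map_mul]), ordAt_eq hπ ha hb h,
    multiplicity_mul_of_ne_zero hπ hc ha]
  push_cast
  ring

theorem exists_algebraMap_eq_of_ordAt_nonneg {x : FractionRing A}
    (h : ∀ π : A, Prime π → 0 ≤ ordAt π x) : ∃ a : A, algebraMap A (FractionRing A) a = x := by
  apply IsFractionRing.isInteger_of_isUnit_den (A := A)
  by_contra hden
  have hden0 : (IsFractionRing.den A x : A) ≠ 0 := nonZeroDivisors.coe_ne_zero _
  obtain ⟨π, hπ, hdvd⟩ := WfDvdMonoid.exists_irreducible_factor hden hden0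
  have hπ' : Prime π := UniqueFactorizationMonoid.irreducible_iff_prime.1 hπ
  have h1 : ¬ π ∣ IsFractionRing.num A x := fun h' =>
    hπ'.not_isUnit (IsFractionRing.num_den_reduced A x h' hdvd)
  have h2 : multiplicity π (IsFractionRing.den A x : A) ≠ 0 := by
    rw [Ne, multiplicity_eq_zero]
    exact fun h' => h' hdvd
  have h3 := h π hπ'
  rw [ordAt, multiplicity_eq_zero.2 h1] at h3
  omega

theorem multiplicity_le_one_of_squarefree {π f : A} (hπ : Prime π) (hf : Squarefree f) :
    multiplicity π f ≤ 1 := by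
  by_contra! h
  have h1 : π ^ 2 ∣ f := pow_dvd_of_le_multiplicity h
  rw [pow_two] at h1
  exact hπ.not_isUnit (hf π h1)

end Order

/-! ### Witt vectors over a field of fractions -/

section WittCoeff

variable {p : ℕ} [Fact p.Prime] {R : Type*} [CommRing R]

theorem coeff_teichmuller_mul [CharP R p] (a : R) (z : WittVector p R) (i : ℕ) :
    (WittVector.teichmuller p a * z).coeff i = a ^ p ^ i * z.coeff i := by
  induction i generalizing a z with
  | zero => simp [WittVector.mul_coeff_zero]
  | succ i ih =>
    have h1 : WittVector.teichmuller p a * z = WittVector.teichmuller p (a * z.coeff 0) +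
        WittVector.verschiebung (WittVector.teichmuller p (a ^ p) * z.shift 1) := by
      conv_lhs => rw [teichmuller_add_verschiebung_shift z]
      rw [mul_add, map_mul, mul_comm _ (WittVector.verschiebung _),
        ← WittVector.verschiebung_mul_frobenius, frobenius_teichmuller, map_pow,
        mul_comm (z.shift 1)]
    have h2 := teichmuller_add_verschiebung_shift (WittVector.teichmuller p a * z)
    have h3 : (WittVector.teichmuller p a * z).coeff 0 = a * z.coeff 0 := by
      simp [WittVector.mul_coeff_zero]
    rw [h3] at h2
    have h4 := WittVector.verschiebung_injective p _ (add_left_cancel (h2.symm.trans h1))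
    have h5 := congrArg (fun x => WittVector.coeff x i) h4
    simp only [WittVector.shift_coeff, ih] at h5
    rw [add_comm i 1, h5, ← pow_mul, pow_add, pow_one]

theorem coeff_verschiebung_teichmuller (j i : ℕ) (y : R) :
    (WittVector.verschiebung^[j] (WittVector.teichmuller p y)).coeff i =
      if i = j then y else 0 := by
  rcases Nat.lt_or_ge i j with h | h
  · rw [if_neg h.ne, WittVector.iterate_verschiebung_coeff_eq_zero _ h]
  · obtain ⟨l, rfl⟩ := Nat.exists_eq_add_of_le' h
    rw [WittVector.iterate_verschiebung_coeff]
    cases l with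
    | zero => simp
    | succ l => rw [WittVector.teichmuller_coeff_pos p _ _ l.succ_pos, if_neg (by omega)]

theorem verschiebung_iterate_mul_frobenius_teichmuller [CharP R p] (j : ℕ) (a y : R) :
    WittVector.frobenius (WittVector.teichmuller p a) *
        WittVector.verschiebung^[j] (WittVector.teichmuller p y) =
      WittVector.verschiebung^[j] (WittVector.teichmuller p (a ^ p ^ (j + 1) * y)) := by
  have h2 : ∀ i : ℕ, WittVector.frobenius^[i] (WittVector.teichmuller p a) =
      WittVector.teichmuller p (a ^ p ^ i) := by
    intro i
    induction i with
    | zero => simp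
    | succ i ih => rw [Function.iterate_succ_apply', ih, frobenius_teichmuller, ← map_pow,
        ← pow_mul, ← pow_succ]
  rw [mul_comm, WittVector.iterate_verschiebung_mul_left, ← Function.iterate_succ_apply, h2,
    ← map_mul, mul_comm y]

end WittCoeff

/-! ### Quasi-`F`-splittings of pairs -/

section Pair

variable {A : Type*} [CommRing A] [IsDomain A] [UniqueFactorizationMonoid A] {p : ℕ}
  [Fact p.Prime] {f : A}

theorem algebraMap_fractionRing_ne_zero {a : A} (ha : a ≠ 0) : algebraMap A (FractionRing A) a ≠ 0 := by
  rw [Ne, ← map_zero (algebraMap A (FractionRing A)),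
    (IsFractionRing.injective A (FractionRing A)).eq_iff]
  exact ha

theorem mem_divSections_ratDiv (hf : f ≠ 0) {c : ℚ} {i : ℕ} {x : FractionRing A} :
    (x ∈ divSections fun π : A => (p : ℚ) ^ i * ((p : ℚ) * ratDiv c f π)) ↔
      x = 0 ∨ ∀ π : A, Prime π →
        0 ≤ (ordAt π x : ℚ) + (p : ℚ) ^ (i + 1) * c * (multiplicity π f : ℚ) := by
  have h : ∀ π : A, Prime π → (p : ℚ) ^ i * ((p : ℚ) * ratDiv c f π) =
      (p : ℚ) ^ (i + 1) * c * (multiplicity π f : ℚ) := by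
    intro π hπ
    rw [ratDiv, ordAt_algebraMap hπ hf]
    push_cast
    ring
  refine or_congr_right (forall_congr' fun π => forall_congr' fun hπ => ?_)
  dsimp only
  rw [h π hπ]

theorem one_sub_two_div_nonneg (n : ℕ) (hn : 0 < n) : (0 : ℚ) ≤ 1 - 2 / (p : ℚ) ^ n := by
  have hp := (Fact.out : p.Prime)
  have h : (2 : ℚ) ≤ (p : ℚ) ^ n := by
    exact_mod_cast hp.two_le.trans (Nat.le_self_pow hn.ne' p)
  rw [sub_nonneg, div_le_one (by linarith)]
  exact h

theorem algebraMap_mem_divSections (hf : f ≠ 0) {c : ℚ} (hc : 0 ≤ c) (i : ℕ) (a : A) :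
    algebraMap A (FractionRing A) a ∈
      divSections fun π : A => (p : ℚ) ^ i * ((p : ℚ) * ratDiv c f π) := by
  rw [mem_divSections_ratDiv hf]
  by_cases ha : a = 0
  · exact Or.inl (by rw [ha, map_zero])
  · refine Or.inr fun π hπ => ?_
    rw [ordAt_algebraMap hπ ha]
    push_cast
    positivity

theorem div_pow_mem_divSections (hf : f ≠ 0) {c : ℚ} {i s : ℕ}
    (hs : (s : ℚ) ≤ (p : ℚ) ^ (i + 1) * c) (b : A) :
    algebraMap A (FractionRing A) b / algebraMap A (FractionRing A) f ^ s ∈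
      divSections fun π : A => (p : ℚ) ^ i * ((p : ℚ) * ratDiv c f π) := by
  rw [mem_divSections_ratDiv hf]
  by_cases hb : b = 0
  · exact Or.inl (by rw [hb, map_zero, zero_div])
  · refine Or.inr fun π hπ => ?_
    have hf' := algebraMap_fractionRing_ne_zero hf
    rw [ordAt_eq hπ hb (pow_ne_zero s hf) (by rw [map_pow, div_mul_cancel₀ _ (pow_ne_zero s hf')]),
      multiplicity_pow_of_ne_zero hπ hf]
    push_cast
    have := mul_le_mul_of_nonneg_right hs (Nat.cast_nonneg (α := ℚ) (multiplicity π f))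
    have h2 : (0 : ℚ) ≤ (multiplicity π b : ℚ) := Nat.cast_nonneg _
    linarith

theorem verschiebung_teichmuller_mem_wittSections {E : A → ℚ} {n j : ℕ} {y : FractionRing A}
    (hy : y ∈ divSections fun π => (p : ℚ) ^ j * E π) :
    WittVector.truncate n (WittVector.verschiebung^[j] (WittVector.teichmuller p y)) ∈
      wittSections p n E := by
  intro i
  rw [WittVector.coeff_truncate, coeff_verschiebung_teichmuller]
  split_ifs with h
  · rw [h]
    exact hy
  · exact Or.inl rfl

theorem wittMap_truncate {R S : Type*} [CommRing R] [CommRing S] (g : R →+* S) (n : ℕ)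
    (x : WittVector p R) :
    wittMap g (WittVector.truncate n x) = WittVector.truncate n (WittVector.map g x) := by
  ext i
  simp [wittMap, WittVector.map_coeff]

theorem wittF_truncate {R : Type*} [CommRing R] [CharP R p] (n : ℕ) (x : WittVector p R) :
    wittF p (WittVector.truncate n x) = WittVector.truncate n (WittVector.frobenius x) := by
  ext i
  simp [wittF, WittVector.coeff_frobenius_charP]

variable [CharP A p]

theorem charP_fractionRing : CharP (FractionRing A) p :=
  charP_of_injective_algebraMap (IsFractionRing.injective A (FractionRing A)) p

/-- A pair which has a section `y` of the right order with `a ^ p ^ (j + 1) * y = b` only has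
splittings whose value at `V^j[b]` is divisible by `a`. -/
theorem dvd_of_pair {n : ℕ} (hn : 0 < n) {E : A → ℚ}
    {φ : TruncatedWittVector p n (FractionRing A) → A}
    (h2 : ∀ w : TruncatedWittVector p n A, ∀ α ∈ wittSections p n E,
      φ (wittMap (algebraMap A (FractionRing A)) (wittF p w) * α) = w.coeff ⟨0, hn⟩ * φ α)
    {j : ℕ} {a b : A} {y : FractionRing A} (hy : y ∈ divSections fun π => (p : ℚ) ^ j * E π)
    (hyb : algebraMap A (FractionRing A) a ^ p ^ (j + 1) * y = algebraMap A (FractionRing A) b) :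
    a ∣ φ (WittVector.truncate n (WittVector.map (algebraMap A (FractionRing A))
      (WittVector.verschiebung^[j] (WittVector.teichmuller p b)))) := by
  have := charP_fractionRing (A := A) (p := p)
  have h := h2 (WittVector.truncate n (WittVector.teichmuller p a)) _
    (verschiebung_teichmuller_mem_wittSections (n := n) hy)
  have hF : WittVector.map (algebraMap A (FractionRing A))
      (WittVector.frobenius (WittVector.teichmuller p a)) =
      WittVector.frobenius (WittVector.teichmuller p (algebraMap A (FractionRing A) a)) := by
    rw [frobenius_teichmuller, frobenius_teichmuller, map_pow, WittVector.map_teichmuller]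
  rw [wittF_truncate, wittMap_truncate, ← map_mul, hF,
    verschiebung_iterate_mul_frobenius_teichmuller, hyb] at h
  rw [map_verschiebung_iterate, WittVector.map_teichmuller, h, WittVector.coeff_truncate,
    WittVector.teichmuller_coeff_zero]
  exact Dvd.intro _ rfl

theorem wittMap_truncate_mem_wittSections (hf : f ≠ 0) {n : ℕ} {c : ℚ} (hc : 0 ≤ c)
    (x : WittVector p A) :
    WittVector.truncate n (WittVector.map (algebraMap A (FractionRing A)) x) ∈
      wittSections p n (fun π : A => (p : ℚ) * ratDiv c f π) := by
  intro i
  rw [WittVector.coeff_truncate, WittVector.map_coeff]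
  exact algebraMap_mem_divSections hf hc i _

/-- The multiples of sections by a power of `f`, for `f` squarefree. -/
theorem exists_algebraMap_eq_pow_mul (hf : f ≠ 0) (hsq : Squarefree f) {m i : ℕ} (hi : i ≤ m)
    {x : FractionRing A} (hx : x ∈ divSections fun π : A =>
      (p : ℚ) ^ i * ((p : ℚ) * ratDiv (1 - 2 / (p : ℚ) ^ (m + 1)) f π)) :
    ∃ a, algebraMap A (FractionRing A) a =
      algebraMap A (FractionRing A) f ^ (p ^ (i + 1) - if i = m then 2 else 1) * x := by
  have hp := (Fact.out : p.Prime)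
  rw [mem_divSections_ratDiv hf] at hx
  rcases hx with rfl | hx
  · exact ⟨0, by rw [map_zero, mul_zero]⟩
  by_cases hx0 : x = 0
  · exact ⟨0, by rw [hx0, map_zero, mul_zero]⟩
  refine exists_algebraMap_eq_of_ordAt_nonneg fun π hπ => ?_
  rw [← map_pow, ordAt_algebraMap_mul hπ (pow_ne_zero _ hf) hx0,
    multiplicity_pow_of_ne_zero hπ hf]
  have h1 := hx π hπ
  have h2 : 2 ≤ p ^ (i + 1) := hp.two_le.trans (Nat.le_self_pow (by omega) p)
  have hpos : (0 : ℚ) < (p : ℚ) ^ (m + 1) := by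
    have : (0 : ℚ) < p := by exact_mod_cast hp.pos
    positivity
  have hpos' : (0 : ℚ) < (p : ℚ) ^ (i + 1) := by
    have : (0 : ℚ) < p := by exact_mod_cast hp.pos
    positivity
  have hle := multiplicity_le_one_of_squarefree hπ hsq
  rcases Nat.lt_or_ge i m with him | him
  · rw [if_neg him.ne]
    rcases Nat.le_one_iff_eq_zero_or_eq_one.1 hle with h0 | h0
    · rw [h0] at h1 ⊢
      have h3 : (0 : ℚ) ≤ (ordAt π x : ℚ) := by simpa using h1
      have h4 : 0 ≤ ordAt π x := by exact_mod_cast h3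
      simpa using h4
    · rw [h0] at h1 ⊢
      -- Rounding for i < m: the order exceeds -p^(i+1) strictly, hence is at least 1 - p^(i+1) as
      -- an integer. This needs multiplicity 1 of f along π.
      have h3 : (0 : ℚ) < (p : ℚ) ^ (i + 1) * (2 / (p : ℚ) ^ (m + 1)) := by positivity
      have h4 : (-(p : ℚ) ^ (i + 1) : ℚ) < (ordAt π x : ℚ) := by
        push_cast at h1
        linarith
      have h5 : -(p : ℤ) ^ (i + 1) < ordAt π x := by exact_mod_cast h4
      push_cast [Nat.cast_sub (show 1 ≤ p ^ (i + 1) by omega)]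
      linarith
  · obtain rfl : i = m := by omega
    rw [if_pos rfl]
    have h3 : (p : ℚ) ^ (i + 1) * (1 - 2 / (p : ℚ) ^ (i + 1)) = (p : ℚ) ^ (i + 1) - 2 := by
      rw [mul_sub, mul_one, mul_div_cancel₀ _ hpos.ne']
    rw [h3] at h1
    have h4 : (0 : ℤ) ≤ ordAt π x + ((p : ℤ) ^ (i + 1) - 2) * multiplicity π f := by
      exact_mod_cast h1
    push_cast [Nat.cast_sub h2]
    linarith

end Pair

/-! ### Splittings of pairs and splitting functionals. -/

section PairSplitting

variable {σ k : Type*} [Finite σ] [Field k] {p : ℕ} [Fact p.Prime] [CharP k p]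
  {f : MvPolynomial σ k}

/-- When p^(j+1) - s is at most p^(j+1)(1 - 2/p^n), the quotient b / f^(p^(j+1) - s) is an
admissible j-th component, and F[f] carries it to f^s b; so the splitting takes a value divisible by
f at V^j[f^s b]. One may take s = 1 for j + 1 < n, where 2/p^(n-j-1) ≤ 1, and s = 2 for j + 1 = n.
-/
theorem IsNQuasiFSplitPair.exists_isSplitting (hf : f ≠ 0) {n : ℕ}
    (H : IsNQuasiFSplitPair p n (ratDiv (1 - 2 / (p : ℚ) ^ n) f)) :
    ∃ χ, IsSplitting p n 2 f χ := by
  obtain ⟨hn, φ, h1, h2, h3⟩ := H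
  have hp := (Fact.out : p.Prime)
  set ι := algebraMap (MvPolynomial σ k) (FractionRing (MvPolynomial σ k)) with hι
  have hmem := wittMap_truncate_mem_wittSections (p := p) hf (n := n)
    (one_sub_two_div_nonneg (p := p) n hn)
  have hf' : ι f ≠ 0 := algebraMap_fractionRing_ne_zero hf
  have hpp : (0 : ℚ) < p := by exact_mod_cast hp.pos
  have hle : ∀ j, 2 ≤ p ^ (j + 1) := fun j => hp.two_le.trans (Nat.le_self_pow (by omega) p)
  have hF : ∀ x : WittVector p (MvPolynomial σ k),
      wittMap ι (wittF p (WittVector.truncate n x)) =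
        WittVector.truncate n (WittVector.map ι (WittVector.frobenius x)) := fun x => by
    rw [wittF_truncate, wittMap_truncate]
  let ψ : WittVector p (MvPolynomial σ k) →+ MvPolynomial σ k :=
    AddMonoidHom.mk' (fun x => φ (WittVector.truncate n (WittVector.map ι x))) fun x y => by
      rw [map_add, map_add]
      exact h1 _ (hmem x) _ (hmem y)
  have hdiv : ∀ j s b, s ≤ p ^ (j + 1) →
      ((p ^ (j + 1) - s : ℕ) : ℚ) ≤ (p : ℚ) ^ (j + 1) * (1 - 2 / (p : ℚ) ^ n) →
      f ∣ φ (WittVector.truncate n (WittVector.map ι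
        (WittVector.verschiebung^[j] (WittVector.teichmuller p (f ^ s * b))))) := by
    intro j s b hs hsle
    refine dvd_of_pair hn h2 (div_pow_mem_divSections hf hsle b) ?_
    rw [← hι, map_mul, map_pow, mul_div_assoc', div_eq_iff (pow_ne_zero _ hf')]
    conv_lhs => rw [← Nat.add_sub_of_le hs, pow_add]
    ring
  refine ⟨(Ideal.Quotient.mk (Ideal.span {f})).toAddMonoidHom.comp ψ,
    ⟨fun w α => ?_, fun j hj α => ?_, ?_, fun j b hj => ?_, fun j b hj => ?_⟩⟩
  · change Ideal.Quotient.mk _ (φ _) = Ideal.Quotient.mk _ _ * Ideal.Quotient.mk _ (φ _)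
    rw [← map_mul, map_mul (WittVector.map ι), map_mul (WittVector.truncate n), ← hF,
      h2 _ _ (hmem α)]
    rfl
  · change Ideal.Quotient.mk _ (φ _) = 0
    have h4 := ψ.map_zero
    change φ _ = 0 at h4
    rw [map_zero, map_zero] at h4
    rw [truncate_map_verschiebung ι hj, h4, map_zero]
  · change Ideal.Quotient.mk _ (φ _) = 1
    have h4 := h3 (WittVector.truncate n 1)
    rw [hF, map_one WittVector.frobenius] at h4
    rw [h4, WittVector.coeff_truncate, WittVector.one_coeff_zero, map_one]
  · change Ideal.Quotient.mk _ (φ _) = 0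
    rw [mk_span_eq_zero_iff]
    have h5 := hdiv j 1 b (by have := hle j; omega) ?_
    · rwa [pow_one] at h5
    · obtain ⟨t, rfl⟩ : ∃ t, n = j + 1 + (t + 1) := ⟨n - j - 2, by omega⟩
      rw [Nat.cast_sub (by have := hle j; omega), pow_add (p : ℚ) (j + 1) (t + 1), mul_sub, mul_one,
        mul_div_assoc', mul_comm _ (2 : ℚ), mul_comm ((p : ℚ) ^ (j + 1)) ((p : ℚ) ^ (t + 1)),
        mul_div_mul_right _ _ (by positivity)]
      have h6 : (2 : ℚ) ≤ (p : ℚ) ^ (t + 1) := by exact_mod_cast hle t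
      have h7 : 2 / (p : ℚ) ^ (t + 1) ≤ 1 := by rw [div_le_one (by positivity)]; exact h6
      push_cast
      linarith
  · change Ideal.Quotient.mk _ (φ _) = 0
    rw [mk_span_eq_zero_iff]
    refine hdiv j 2 b (hle j) ?_
    rw [← hj, Nat.cast_sub (hle j), mul_sub, mul_one, mul_div_cancel₀ _ (by positivity)]
    push_cast
    exact le_rfl

/-- The splitting of the pair is α ↦ φ(F[f] α) / f. Multiplication by F[f] clears the poles and puts
the components in (f), …, (f), (f^2), where φ takes values in (f). -/
theorem isNQuasiFSplitPair_of_splitting (hf : f ≠ 0) (hsq : Squarefree f) {m : ℕ}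
    {φ : WittVector p (MvPolynomial σ k) →+ MvPolynomial σ k}
    (h1 : ∀ w α, φ (WittVector.frobenius w * α) = w.coeff 0 * φ α)
    (h2 : ∀ j, m + 1 ≤ j → ∀ α, φ (WittVector.verschiebung^[j] α) = 0) (h3 : φ 1 = 1)
    (h4 : ∀ α : WittVector p (MvPolynomial σ k), (∀ i, i < m → f ∣ α.coeff i) →
        f ^ 2 ∣ α.coeff m → f ∣ φ α) :
    IsNQuasiFSplitPair p (m + 1) (ratDiv (1 - 2 / (p : ℚ) ^ (m + 1)) f) := by
  classical
  have hp := (Fact.out : p.Prime)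
  have := charP_fractionRing (A := MvPolynomial σ k) (p := p)
  set ι := algebraMap (MvPolynomial σ k) (FractionRing (MvPolynomial σ k)) with hι
  have hinj : Function.Injective ι := IsFractionRing.injective _ _
  let τ : WittVector p (MvPolynomial σ k) →+*
      TruncatedWittVector p (m + 1) (FractionRing (MvPolynomial σ k)) :=
    (WittVector.truncate (m + 1)).comp (WittVector.map ι)
  have hτc : ∀ x (i : Fin (m + 1)), (τ x).coeff i = ι (x.coeff i) := fun x i => by
    rw [RingHom.comp_apply, WittVector.coeff_truncate, WittVector.map_coeff]
  have hτ : ∀ x y, τ x = τ y → φ x = φ y := by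
    intro x y hxy
    rw [← sub_eq_zero, ← map_sub]
    have h0 : τ (x - y) = 0 := by rw [map_sub, hxy, sub_self]
    have h5 : ∀ i, i < m + 1 → (x - y).coeff i = 0 := by
      intro i hi
      apply hinj
      rw [← hτc (x - y) ⟨i, hi⟩, h0, TruncatedWittVector.coeff_zero, map_zero]
    rw [WittVector.eq_iterate_verschiebung h5]
    exact h2 _ le_rfl _
  have hF : ∀ x : WittVector p (MvPolynomial σ k),
      wittMap ι (wittF p (WittVector.truncate (m + 1) x)) = τ (WittVector.frobenius x) :=
    fun x => by rw [wittF_truncate, wittMap_truncate]; rfl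
  set F := WittVector.frobenius (WittVector.teichmuller p f) with hFdef
  let P : TruncatedWittVector p (m + 1) (FractionRing (MvPolynomial σ k)) → MvPolynomial σ k →
    -- The value at α is recorded as a relation. It is single-valued because φ factors through
    -- length m + 1 and f can be cancelled.
    Prop := fun α c => ∃ x, τ x = τ F * α ∧ φ x = f * c
  have huniq : ∀ α c c', P α c → P α c' → c = c' := by
    rintro α c c' ⟨x, hx, hc⟩ ⟨x', hx', hc'⟩
    have h5 := hτ x x' (hx.trans hx'.symm)
    rw [hc, hc'] at h5
    exact mul_left_cancel₀ hf h5
  have hex : ∀ α ∈ wittSections p (m + 1)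
      (fun π => (p : ℚ) * ratDiv (1 - 2 / (p : ℚ) ^ (m + 1)) f π), ∃ c, P α c := by
    intro α hα
    have h5 : ∀ i, ∃ a, ∀ hi : i < m + 1, ι a =
        ι f ^ (p ^ (i + 1) - if i = m then 2 else 1) * α.coeff ⟨i, hi⟩ := by
      intro i
      by_cases hi : i < m + 1
      · obtain ⟨a, ha⟩ := exists_algebraMap_eq_pow_mul hf hsq (Nat.lt_succ_iff.1 hi) (hα ⟨i, hi⟩)
        exact ⟨a, fun _ => ha⟩
      · exact ⟨0, fun hi' => absurd hi' hi⟩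
    choose a ha using h5
    -- The components of F[f] α are f^(p^(i+1)) α_i. One factor f, or two for i = m, is set aside,
    -- and the rest already makes α_i integral. Components beyond m do not matter.
    let x : WittVector p (MvPolynomial σ k) :=
      WittVector.mk p fun i => f ^ (if i = m then 2 else 1) * a i
    have hxc : ∀ i, x.coeff i = f ^ (if i = m then 2 else 1) * a i :=
      fun i => rfl
    have hx : τ x = τ F * α := by
      have h6 : τ F * α = WittVector.truncate (m + 1)
          (WittVector.teichmuller p (ι f ^ p) * α.out) := by
        rw [map_mul, WittVector.truncate]
        congr 1
        · change WittVector.truncate (m + 1) (WittVector.map ι F) = _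
          rw [hFdef, frobenius_teichmuller, ← map_pow, WittVector.map_teichmuller, map_pow]
          rfl
        · exact (TruncatedWittVector.truncateFun_out α).symm
      rw [h6]
      ext i
      rw [hτc, WittVector.coeff_truncate, coeff_teichmuller_mul, TruncatedWittVector.coeff_out,
        hxc, map_mul, map_pow, ha i i.2, ← mul_assoc, ← pow_add, ← pow_mul, ← pow_succ']
      congr 2
      have h7 : 2 ≤ p ^ ((i : ℕ) + 1) := hp.two_le.trans (Nat.le_self_pow (by omega) p)
      split_ifs <;> omega
    obtain ⟨c, hc⟩ := h4 x
      (fun i hi => by rw [hxc, if_neg hi.ne, pow_one]; exact Dvd.intro _ rfl)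
      (by rw [hxc, if_pos rfl]; exact Dvd.intro _ rfl)
    exact ⟨c, x, hx, hc⟩
  let Φ : TruncatedWittVector p (m + 1) (FractionRing (MvPolynomial σ k)) → MvPolynomial σ k :=
    fun α => if h : ∃ c, P α c then h.choose else 0
  have hΦ : ∀ α c, P α c → Φ α = c := by
    intro α c hc
    have h5 : ∃ c, P α c := ⟨c, hc⟩
    have h6 : Φ α = h5.choose := dif_pos h5
    rw [h6]
    exact huniq α _ _ h5.choose_spec hc
  refine ⟨Nat.succ_pos m, Φ, fun α hα β hβ => ?_, fun w α hα => ?_, fun w => ?_⟩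
  · obtain ⟨c, x, hx, hc⟩ := hex α hα
    obtain ⟨c', x', hx', hc'⟩ := hex β hβ
    rw [hΦ α c ⟨x, hx, hc⟩, hΦ β c' ⟨x', hx', hc'⟩]
    exact hΦ _ _ ⟨x + x', by rw [map_add, hx, hx', mul_add], by rw [map_add, hc, hc', mul_add]⟩
  · obtain ⟨c, x, hx, hc⟩ := hex α hα
    obtain ⟨w, rfl⟩ := WittVector.truncate_surjective p _ _ w
    rw [hF, hΦ α c ⟨x, hx, hc⟩, WittVector.coeff_truncate]
    refine hΦ _ _ ⟨WittVector.frobenius w * x, ?_, ?_⟩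
    · rw [map_mul, hx, mul_left_comm]
    · rw [h1, hc, mul_left_comm]
  · obtain ⟨w, rfl⟩ := WittVector.truncate_surjective p _ _ w
    rw [hF, WittVector.coeff_truncate]
    refine hΦ _ _ ⟨WittVector.frobenius (WittVector.teichmuller p f * w) * 1, ?_, ?_⟩
    · rw [mul_one, map_mul, map_mul]
    · rw [h1, h3, mul_one, WittVector.mul_coeff_zero, WittVector.teichmuller_coeff_zero]

end PairSplitting

/-! ### The criterion -/

/-- F kills (x, 0, …, 0), while the splitting must recover x from its image: quasi-F-split rings are
reduced. -/
theorem IsNQuasiFSplit.eq_zero_of_pow_eq_zero {p : ℕ} [Fact p.Prime] {n : ℕ} {R : Type*}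
    [CommRing R] (H : IsNQuasiFSplit p n R) {x : R} (hx : x ^ p = 0) : x = 0 := by
  obtain ⟨hn, φ, -, h⟩ := H
  have hp := (Fact.out : p.Prime)
  have h1 := h (TruncatedWittVector.mk p fun i => if i = ⟨0, hn⟩ then x else 0)
  have h2 : wittF p (TruncatedWittVector.mk p fun i : Fin n =>
      if i = ⟨0, hn⟩ then x else 0) = 0 := by
    ext i
    rw [wittF, TruncatedWittVector.coeff_mk, TruncatedWittVector.coeff_mk,
      TruncatedWittVector.coeff_zero]
    split_ifs
    · exact hx
    · exact zero_pow hp.ne_zero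
  rw [h2, map_zero, TruncatedWittVector.coeff_mk, if_pos rfl] at h1
  exact h1.symm

/-- If f = g^2 h, then (g h)^p lies in (f), so reducedness gives that f divides g h, and cancelling
g h makes g a unit. -/
theorem IsQuasiFSplit.squarefree {p : ℕ} [Fact p.Prime] {A : Type*} [CommRing A] [IsDomain A]
    {f : A} (hf : f ≠ 0) (H : IsQuasiFSplit p (A ⧸ Ideal.span {f})) : Squarefree f := by
  obtain ⟨n, H⟩ := H
  rintro g ⟨h, rfl⟩
  have hp := (Fact.out : p.Prime)
  have h1 : Ideal.Quotient.mk (Ideal.span {g * g * h}) (g * h) ^ p = 0 := by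
    obtain ⟨t, ht⟩ := Nat.exists_eq_add_of_le hp.two_le
    rw [← map_pow, mk_span_eq_zero_iff, ht, pow_add]
    exact Dvd.dvd.mul_right ⟨h, by ring⟩ _
  have h2 := mk_span_eq_zero_iff.1 (H.eq_zero_of_pow_eq_zero h1)
  rw [mul_assoc] at h2 hf
  obtain ⟨c, hc⟩ := h2
  have h3 : g * h * 1 = g * h * (g * c) := by
    rw [mul_one]
    calc g * h = g * (g * h) * c := hc
      _ = _ := by ring
  exact IsUnit.of_mul_eq_one c (mul_left_cancel₀ (right_ne_zero_of_mul hf) h3).symm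

theorem ns_lt_top_iff {p : ℕ} [Fact p.Prime] {A : Type*} [CommRing A] [IsDomain A]
    [UniqueFactorizationMonoid A] {f : A} :
    ns p f < ⊤ ↔ ∃ n, 1 ≤ n ∧ ¬ IsNQuasiFSplitPair p n (ratDiv (1 - 2 / (p : ℚ) ^ n) f) := by
  simp only [ns, iInf_lt_iff, Set.mem_ofPred_eq, ENat.natCast_lt_top, exists_prop, and_true]

/-! ### The equivalence for weighted homogeneous polynomials. -/

section Weighted

variable {σ k : Type*} [Fintype σ] [Field k] {p : ℕ} [Fact p.Prime] [CharP k p] [PerfectRing k p]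
  {w : σ → ℕ} {f : MvPolynomial σ k}

/-- For a nonzero weighted homogeneous polynomial of degree the sum of the weights, the quotient
ring is quasi-`F`-split if and only if the non-splitting index is infinite. -/
theorem isQuasiFSplit_quotient_iff (hw : ∀ i, w i ≠ 0)
    (hf : IsWeightedHomogeneous w f (∑ i, w i)) (hd : 0 < ∑ i, w i) (hf0 : f ≠ 0) :
    IsQuasiFSplit p (MvPolynomial σ k ⧸ Ideal.span {f}) ↔
      ∀ n, 1 ≤ n → IsNQuasiFSplitPair p n (ratDiv (1 - 2 / (p : ℚ) ^ n) f) := by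
  constructor
  · intro H n hn
    have hsq := H.squarefree hf0
    obtain ⟨r, rfl⟩ := Nat.exists_eq_succ_of_ne_zero (Nat.one_le_iff_ne_zero.1 hn)
    obtain ⟨n, H⟩ := H
    obtain ⟨hn0, χ, S⟩ := H.exists_isSplitting
    obtain ⟨m, rfl⟩ := Nat.exists_eq_succ_of_ne_zero hn0.ne'
    obtain ⟨a, ha⟩ := S.exists_isChain hw hf hd hf0 one_le_two
    have ha' : IsChain (gradedChainMap p hf) (gradedChainEnd p w f) ⟨f, hf⟩
        (fun x => ∃ b : k, x = b • (⟨f, hf⟩ :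
          weightedHomogeneousSubmodule k w (∑ i, w i))) m a :=
      ⟨ha.1, ha.2.1, ha.2.2.1, ha.2.2.2 rfl⟩
    obtain ⟨c, hc⟩ : ∃ c, IsChain (gradedChainMap p hf) (gradedChainEnd p w f) ⟨f, hf⟩
        (fun _ => True) r c := by
      -- The splitting of the ring has length m + 1 and the pair asks for r + 1: the chain is
      -- truncated, or padded with zeros, which is possible since it ends in k f.
      rcases le_total r m with h | h
      · exact ⟨a, ha'.of_le h⟩
      · obtain ⟨c, hc⟩ := ha'.exists_of_le h
        exact ⟨c, hc.of_le le_rfl⟩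
    obtain ⟨φ, h1, h2, h3, h4⟩ := IsChain.exists_splitting hw hf (r := 2) one_le_two le_rfl
      ⟨hc.1, hc.2.1, hc.2.2.1, fun h => absurd h (by norm_num)⟩
    exact isNQuasiFSplitPair_of_splitting hf0 hsq h1 h2 h3 h4
  · intro H
    have : FiniteDimensional k (weightedHomogeneousSubmodule k w (∑ i, w i)) :=
      Module.Finite.iff_fg.2 (weightedHomogeneousSubmodule_fg k w hw _)
    have hchain : ∀ m, ∃ a, IsChain (gradedChainMap p hf) (gradedChainEnd p w f) ⟨f, hf⟩
        (fun _ => True) m a := by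
      intro m
      obtain ⟨χ, S⟩ := (H (m + 1) (Nat.le_add_left 1 m)).exists_isSplitting hf0
      obtain ⟨a, ha⟩ := S.exists_isChain hw hf hd hf0 le_rfl
      exact ⟨a, ha.of_le le_rfl⟩
    obtain ⟨m, a, ha⟩ := exists_isChain_smul (gradedChainMap_smul hf) gradedChainEnd_smul hchain
    obtain ⟨φ, h1, -, h3, h4⟩ := IsChain.exists_splitting hw hf (r := 1) le_rfl one_le_two
      ⟨ha.1, ha.2.1, ha.2.2.1, fun _ => ha.2.2.2⟩
    exact ⟨m + 1, isNQuasiFSplit_of_splitting h1 h3 h4⟩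

end Weighted

/-! ### The polynomials G(b). -/

section CalabiYau

variable {k : Type*} [Field k] {N : ℕ} {q : Fin (N + 1) → ℕ} {b : cyExponents q → k}

theorem coeff_cyPoly (α : cyExponents q) :
    coeff (Finsupp.equivFunOnFinite.symm α.1) (cyPoly q b) = b α := by
  classical
  rw [cyPoly, coeff_sum, Finset.sum_eq_single α]
  · rw [coeff_monomial, if_pos rfl]
  · intro β _ hβ
    rw [coeff_monomial, if_neg]
    exact fun h => hβ (Subtype.ext (Finsupp.equivFunOnFinite.symm.injective h))
  · exact fun h => absurd (Finset.mem_univ _) h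

theorem cyPoly_ne_zero (hb : b ≠ 0) : cyPoly q b ≠ 0 := by
  intro h
  refine hb (funext fun α => ?_)
  rw [← coeff_cyPoly (b := b), h, coeff_zero, Pi.zero_apply]

theorem isWeightedHomogeneous_cyPoly (hq : ∀ i, 0 < q i) :
    IsWeightedHomogeneous q (cyPoly q b) (∑ i, q i) := by
  refine IsWeightedHomogeneous.sum _ _ _ fun α _ => ?_
  refine isWeightedHomogeneous_monomial _ _ _ ?_
  rw [Finsupp.weight_apply, Finsupp.sum_fintype _ _ fun i => zero_smul ℕ (q i),
    ← (mem_cyExponents hq _).1 α.2]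
  exact Finset.sum_congr rfl fun i _ => mul_comm _ _

end CalabiYau

end QuasiFSplit

end

theorem corollary3p6 (p : ℕ) [Fact p.Prime] (k : Type*) [Field k] [IsAlgClosed k] [CharP k p]
    (N : ℕ) (q : Fin (N + 1) → ℕ) (hq : ∀ i, 0 < q i)
    (b : QuasiFSplit.cyExponents q → k) (hb : b ≠ 0) :
    ¬ QuasiFSplit.IsQuasiFSplit p
        (MvPolynomial (Fin (N + 1)) k ⧸ Ideal.span {QuasiFSplit.cyPoly q b}) ↔
      QuasiFSplit.ns p (QuasiFSplit.cyPoly q b) < ⊤ := by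
  rw [QuasiFSplit.ns_lt_top_iff, QuasiFSplit.isQuasiFSplit_quotient_iff (fun i => (hq i).ne')
    (QuasiFSplit.isWeightedHomogeneous_cyPoly hq)
    (Finset.sum_pos (fun i _ => hq i) Finset.univ_nonempty) (QuasiFSplit.cyPoly_ne_zero hb)]
  push Not
  rfl
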